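/- **Setting.** Let $d\in\mathbb N$. *Hopping.* Let $h:\mathbb Z^d\to\mathbb C$ satisfy $h(\zeta)=\overline{h(-\zeta)}$, $\sum_y e^{m|y|}|h(y)|<\infty$ for some $m>0$, and: for every $0\ne k\in\mathbb R^d$ there is $y$ with $k\cdot y\neq 0$ and $h(y)\ne 0$. *Environment.* Let $\Omega$ be a topological space with its Borel $\sigma$-algebra, $\mu$ a Borel probability measure, and $\sigma_x:\Omega\to\Omega$ ($x\in\mathbb Z^d$) $\mu$-preserving maps with $\sigma_0=\mathrm{id}$, $\sigma_x\circ\sigma_y=\sigma_{x+y}$. Let $(\mathbb P_a)_{a\in\Omega}$ be a measurable family of probability measures on $\Omega^{[0,\infty)}$ (product $\sigma$-algebra) such that: under $\mathbb P_a$ almost surely the path $t\mapsto \omega_t$ is right continuous with $\omega_0=a$ (i.e. the set of such paths has outer measure one); $\mathbb P_{\sigma_xa}$ is the image of $\mathbb P_a$ under $(\omega_t)_t\mapsto(\sigma_x\omega_t)_t$; $\mathbb P_a((\omega_{t+s})_{t\ge0}\in A)=\mathbb E_a(\mathbb P_{\omega_s}(A))$ for $s>0$ and measurable $A$; and $\int\mathbb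 P_a(\omega_t\in A)\,d\mu(a)=\mu(A)$ for $t>0$ and Borel $A$. Let $S_t^\dagger$ be the operators on $L^2(\Omega)=L^2(\Omega,\mu;\mathbb C)$ with $\langle g,S_t^\dagger f\rangle=\int\mathbb E_a\big(\overline{g(\omega_t)}f(\omega_0)\big)d\mu(a)$, and let $Bf=\lim_{t\downarrow0}\frac1t(f-S_t^\dagger f)$, with domain $\mathcal D(B)$ the set of $f$ for which the limit exists in $L^2$. Assume that there are $T>0$ and $b,q\in\mathbb R$ such that for all $f\in\mathcal D(B)$ with $\int f\,d\mu=0$, $$\operatorname{Re}\langle f,Bf\rangle\ge\tfrac1T\|f\|^2,\qquad |\operatorname{Im}\langle f,Bf\rangle|\le q\,|\operatorname{Re}\langle f,Bf\rangle+b|\ \text{ if moreover } \|f\|=1 .$$ *Potential.* Let $v_0\in L^\infty(\mu)$ be real valued, $v_x=v_0\circ\sigma_x$, and assume that there is $\chi>0$ with $\|B^{-1}(v_x-v_0)\|_{L^2(\Omega)}\ge\chi$ for all $x\ne0$, where $B^{-1}$ is the inverse of $B$ restricted to the mean zero functions. *Operator.* On $\mathcal H=L^2(\mathbb Z^d\times\Omega)$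 (counting measure times $\mu$) let $\widehat L_{0}=\mathrm i\widehat K+\mathrm i\widehat V+B$, where $$\widehat K\phi(x,\omega)=\sum_\zeta h(\zeta)\big[\phi(x-\zeta,\omega)-\phi(x-\zeta,\sigma_\zeta\omega)\big],\qquad \widehat V\phi(x,\omega)=(v_x(\omega)-v_0(\omega))\phi(x,\omega),$$ and $B$ acts on the variable $\omega$, on the domain of those $\phi$ with $\phi(x,\cdot)\in\mathcal D(B)$ for all $x$ and $\sum_x\|B\phi(x,\cdot)\|^2<\infty$. **Claim.** The operator $\widehat L_0$ is densely defined, and: 1. $\widehat L_0(\delta_0\otimes1)=\widehat L_0^\dagger(\delta_0\otimes1)=0$, where $(\delta_0\otimes 1)(x,\omega)=\delta_0(x)$. 2. The subspace $\widetilde{\mathcal H}=\{\delta_0\otimes1\}^\perp$ is invariant under $\widehat L_0$, and there are $0<\gamma<1$ and $p,c>0$ such that the spectrum of the restriction of $\widehat L_0$ to $\widetilde{\mathcal H}$ is contained in $$\Sigma_+=\Big\{w\in\mathbb C:\ \operatorname{Re}w\ge\frac\gamma T,\ |\operatorname{Im}w|\le p\,(\operatorname{Re}w+c)\Big\}.$$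 3. With the same $\Sigma_+$ there is $C<\infty$ such that every $w\notin\{0\}\cup\Sigma_+$ is in the resolvent set of $\widehat L_0$ and $$\big\|(\widehat L_0-wI)^{-1}\big\|\le\frac{C}{\operatorname{dist}(w,\{0\}\cup\Sigma_+)} .$$ -/

import Mathlib

open MeasureTheory ProbabilityTheory Filter Topology
open scoped NNReal ENNReal InnerProductSpace

noncomputable section

namespace MarkovAnderson

/-! ### Unbounded operators -/

section Operators

variable {E : Type*} [NormedAddCommGroup E] [NormedSpace ℂ E]

/-- Graph of the generator `f ↦ lim_{t ↓ 0} t⁻¹ (f - S_t f)`: the pairs `(f, k)` for which the limit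
exists in norm and equals `k`. -/
def generatorGraph (S : ℝ≥0 → E →L[ℂ] E) : Submodule ℂ (E × E) where
  carrier := {a | Tendsto (fun t : ℝ≥0 => ((t : ℝ) : ℂ)⁻¹ • (a.1 - S t a.1)) (𝓝[>] 0) (𝓝 a.2)}
  zero_mem' := by
    simp only [Set.mem_ofPred_eq, Prod.fst_zero, Prod.snd_zero, map_zero, sub_zero, smul_zero]
    exact tendsto_const_nhds
  add_mem' := by
    intro a b ha hb
    refine (Tendsto.add ha hb).congr fun t => ?_
    simp only [Prod.fst_add, map_add, ← smul_add]
    congr 1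
    abel
  smul_mem' := by
    intro c a ha
    refine (Tendsto.const_smul ha c).congr fun t => ?_
    simp only [Prod.smul_fst, map_smul, ← smul_sub]
    exact smul_comm _ _ _

/-- The generator `B` of `S`, with the sign convention `S_t = e^{-tB}`, on its maximal domain. -/
def generator (S : ℝ≥0 → E →L[ℂ] E) : E →ₗ.[ℂ] E := (generatorGraph S).toLinearPMap

theorem mem_generator_graph (S : ℝ≥0 → E →L[ℂ] E) (f k : E) :
    (f, k) ∈ (generator S).graph ↔
      Tendsto (fun t : ℝ≥0 => ((t : ℝ) : ℂ)⁻¹ • (f - S t f)) (𝓝[>] 0) (𝓝 k) := by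
  rw [generator, Submodule.toLinearPMap_graph_eq]
  · rfl
  · rintro ⟨f, k⟩ h (rfl : f = 0)
    refine tendsto_nhds_unique (f := fun _ : ℝ≥0 => (0 : E)) (l := 𝓝[>] (0 : ℝ≥0)) ?_
      tendsto_const_nhds
    exact Tendsto.congr (fun t => by simp) h

/-- `R` is the (bounded, everywhere defined) inverse of `A - w`. -/
def IsResolvent (A : E →ₗ.[ℂ] E) (w : ℂ) (R : E →L[ℂ] E) : Prop :=
  (∀ y, ∃ hy : R y ∈ A.domain, A ⟨R y, hy⟩ - w • R y = y) ∧
    ∀ x : A.domain, R (A x - w • (x : E)) = x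

/-- The spectrum of a partially defined operator: the complement of the resolvent set. -/
def pspectrum (A : E →ₗ.[ℂ] E) : Set ℂ := {w | ¬ ∃ R : E →L[ℂ] E, IsResolvent A w R}

/-- The operator induced by `A` in the subspace `M`: its graph is the part of the graph of `A` that
lies in `M × M`. When `M` is invariant under `A`, this is the restriction of `A` to
`A.domain ∩ M`. -/
def restrictTo (A : E →ₗ.[ℂ] E) (M : Submodule ℂ E) : M →ₗ.[ℂ] M :=
  (A.graph.comap (M.subtype.prodMap M.subtype)).toLinearPMap

theorem mem_restrictTo_graph (A : E →ₗ.[ℂ] E) (M : Submodule ℂ E) (u w : M) :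
    (u, w) ∈ (restrictTo A M).graph ↔ ((u : E), (w : E)) ∈ A.graph := by
  rw [restrictTo, Submodule.toLinearPMap_graph_eq]
  · rfl
  · rintro ⟨u, w⟩ h (rfl : u = 0)
    exact Subtype.ext (A.graph_fst_eq_zero_snd h rfl)

end Operators

/-! ### Operators on `ℓ²(ι; E)` -/

section HilbertSum

variable {ι : Type*} {E : Type*} [NormedAddCommGroup E] [NormedSpace ℂ E]

theorem memℓp_block (e : ι ≃ ι) (U : ι → E →L[ℂ] E) (M : ℝ) (hU : ∀ i, ‖U i‖ ≤ M)
    (φ : lp (fun _ : ι => E) 2) :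
    Memℓp (fun i => U i (φ (e i))) 2 := by
  refine memℓp_gen ?_
  have h := (memℓp_gen_iff (p := 2) (by simp)).1 (lp.memℓp φ)
  have h' := ((e.summable_iff.2 h).mul_left (M ^ 2))
  refine Summable.of_nonneg_of_le (fun i => by positivity) (fun i => ?_) h'
  have := (U i).le_of_opNorm_le (hU i) (φ (e i))
  simp only [ENNReal.toReal_ofNat, Real.rpow_ofNat, Function.comp_apply]
  rw [← mul_pow]
  gcongr

/-- The bounded operator `(φ_i)_i ↦ (U_i φ_{e i})_i` on `ℓ²(ι; E)`. -/
def blockOp (e : ι ≃ ι) (U : ι → E →L[ℂ] E) (M : ℝ) (hU : ∀ i, ‖U i‖ ≤ M) :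
    lp (fun _ : ι => E) 2 →L[ℂ] lp (fun _ : ι => E) 2 :=
  LinearMap.mkContinuous
    { toFun := fun φ => ⟨fun i => U i (φ (e i)), memℓp_block e U M hU φ⟩
      map_add' := fun φ ψ => by
        ext i : 2
        exact (U i).map_add _ _
      map_smul' := fun c φ => by
        ext i : 2
        exact (U i).map_smul c _ }
    (max M 0) (fun φ => by
      refine lp.norm_le_of_forall_sum_le (p := 2) (by simp) (by positivity) fun s => ?_
      simp only [ENNReal.toReal_ofNat, Real.rpow_ofNat, mul_pow]
      have h := (memℓp_gen_iff (p := 2) (by simp)).1 (lp.memℓp φ)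
      have hn := lp.norm_rpow_eq_tsum (p := 2) (by simp) φ
      simp only [ENNReal.toReal_ofNat, Real.rpow_ofNat] at h hn
      rw [hn, ← e.tsum_eq, ← tsum_mul_left]
      refine le_trans (Finset.sum_le_sum fun i _ => ?_)
        (((e.summable_iff.2 h).mul_left ((max M 0) ^ 2)).sum_le_tsum s
          fun i _ => mul_nonneg (sq_nonneg _) (sq_nonneg _))
      simp only [LinearMap.coe_mk, AddHom.coe_mk]
      rw [← mul_pow]
      have := (U i).le_of_opNorm_le ((hU i).trans (le_max_left M 0)) (φ (e i))
      gcongr)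

theorem blockOp_apply (e : ι ≃ ι) (U : ι → E →L[ℂ] E) (M : ℝ) (hU : ∀ i, ‖U i‖ ≤ M)
    (φ : lp (fun _ : ι => E) 2) (i : ι) : blockOp e U M hU φ i = U i (φ (e i)) := rfl

/-- The operator `1 ⊗ B` on `ℓ²(ι; E)`, i.e. the direct sum of copies of `B`: its graph consists of
the pairs `(φ, χ)` in `ℓ²(ι; E)` with `φ_i` in the domain of `B` and `B φ_i = χ_i` for all `i`. -/
def ampliation (ι : Type*) (B : E →ₗ.[ℂ] E) :
    lp (fun _ : ι => E) 2 →ₗ.[ℂ] lp (fun _ : ι => E) 2 :=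
  Submodule.toLinearPMap
    { carrier := {a | ∀ i, (a.1 i, a.2 i) ∈ B.graph}
      zero_mem' := fun _ => B.graph.zero_mem
      add_mem' := fun ha hb i => B.graph.add_mem (ha i) (hb i)
      smul_mem' := fun c _ ha i => B.graph.smul_mem c (ha i) }

theorem mem_ampliation_graph (B : E →ₗ.[ℂ] E) (φ χ : lp (fun _ : ι => E) 2) :
    (φ, χ) ∈ (ampliation ι B).graph ↔ ∀ i, (φ i, χ i) ∈ B.graph := by
  rw [ampliation, Submodule.toLinearPMap_graph_eq]
  · rfl
  · rintro ⟨φ, χ⟩ h (rfl : φ = 0)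
    ext i : 2
    exact B.graph_fst_eq_zero_snd (h i) rfl

end HilbertSum

/-! ### The model -/

/-- A hopping kernel on `ℤ^d`: self-adjoint, exponentially bounded and non-degenerate. -/
structure HoppingKernel (d : ℕ) where
  h : (Fin d → ℤ) → ℂ
  self_adjoint : ∀ ζ, h ζ = starRingEnd ℂ (h (-ζ))
  exp_bound : ∃ m : ℝ, 0 < m ∧ Summable fun y : Fin d → ℤ => Real.exp (m * ‖y‖) * ‖h y‖
  nondegenerate : ∀ k : Fin d → ℝ, k ≠ 0 → ∃ y : Fin d → ℤ, ∑ i, k i * (y i : ℝ) ≠ 0 ∧ h y ≠ 0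

variable {d : ℕ} {Ω : Type*} [MeasurableSpace Ω] {μ : Measure Ω}

/-- The augmented Hilbert space `L²(ℤ^d × Ω)` (counting measure times `μ`), as the space
`ℓ²(ℤ^d; L²(Ω, μ))` of square summable families `φ x = φ(x, ·)`. -/
abbrev AugSpace (d : ℕ) (μ : Measure Ω) : Type _ :=
  lp (fun _ : Fin d → ℤ => Lp ℂ 2 μ) 2

/-- The vector `δ₀ ⊗ 1`. -/
def deltaOne (d : ℕ) (μ : Measure Ω) [IsFiniteMeasure μ] : AugSpace d μ :=
  lp.single 2 0 (Lp.const 2 μ (1 : ℂ))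

/-- For a bounded operator `U` on `L²(Ω, μ)`: `φ ↦ ((x, ·) ↦ U (φ(x - ζ, ·)))`. -/
def translate (ζ : Fin d → ℤ) (U : Lp ℂ 2 μ →L[ℂ] Lp ℂ 2 μ) :
    AugSpace d μ →L[ℂ] AugSpace d μ :=
  blockOp (Equiv.subRight ζ) (fun _ => U) ‖U‖ (fun _ => le_rfl)

/-- Multiplication of `L²` functions by an `L^∞` function. -/
def mulL2 (m : Lp ℂ ∞ μ) : Lp ℂ 2 μ →L[ℂ] Lp ℂ 2 μ :=
  (ContinuousLinearMap.mul ℂ ℂ).holderL μ ∞ 2 2 m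

theorem norm_mulL2_le (m : Lp ℂ ∞ μ) : ‖mulL2 m‖ ≤ ‖m‖ := by
  refine ((ContinuousLinearMap.mul ℂ ℂ).holderL μ ∞ 2 2).le_of_opNorm_le (c := 1) ?_ m |>.trans
    (one_mul _).le
  exact ((ContinuousLinearMap.mul ℂ ℂ).norm_holderL_le (μ := μ) (p := ∞) (q := 2) (r := 2)).trans
    (ContinuousLinearMap.opNorm_mul_le ℂ ℂ)

variable [TopologicalSpace Ω]

/-- The environment: measure preserving shifts `σ_x`, `x ∈ ℤ^d`, of `(Ω, μ)` together with a
shift invariant Markov process on `Ω`, given by its path measures `P_a`, `a ∈ Ω`, on `Ω^[0,∞)`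
with the product σ-algebra, that has right continuous paths and leaves `μ` invariant.

The set of right continuous paths is in general not measurable for the product σ-algebra, and
"almost surely right continuous" means that it has outer measure one. This is what `right_cont`
says, a measure in Mathlib being applied to arbitrary sets as an outer measure. -/
structure Environment (d : ℕ) (μ : Measure Ω) where
  σ : (Fin d → ℤ) → Ω → Ω
  σ_preserving : ∀ x, MeasurePreserving (σ x) μ μ
  σ_zero : σ 0 = id
  σ_add : ∀ x y, σ x ∘ σ y = σ (x + y)
  P : Kernel Ω (ℝ≥0 → Ω)
  isMarkov : IsMarkovKernel P
  right_cont : ∀ a, P a {ω | (∀ t, ContinuousWithinAt ω (Set.Ici t) t) ∧ ω 0 = a} = 1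
  shift_inv : ∀ x a, P (σ x a) = (P a).map (fun ω t => σ x (ω t))
  markov : ∀ s : ℝ≥0, 0 < s → ∀ A : Set (ℝ≥0 → Ω), MeasurableSet A → ∀ a,
    P a ((fun ω t => ω (t + s)) ⁻¹' A) = ∫⁻ ω, P (ω s) A ∂(P a)
  invariant : ∀ t : ℝ≥0, 0 < t → ∀ A : Set Ω, MeasurableSet A →
    ∫⁻ a, P a {ω | ω t ∈ A} ∂μ = μ A

namespace Environment

variable (X : Environment d μ)

/-- The joint law of the paths with initial point distributed according to `μ`; integrals with
respect to it are the joint average `∫ E_a(·) dμ(a)`. -/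
def pathLaw : Measure (ℝ≥0 → Ω) := μ.bind X.P

theorem prob_initial (a : Ω) {A : Set Ω} (hA : MeasurableSet A) :
    X.P a {ω | ω 0 ∈ A} = A.indicator 1 a := by
  have := X.isMarkov
  by_cases ha : a ∈ A
  · rw [Set.indicator_of_mem ha, Pi.one_apply]
    refine le_antisymm prob_le_one ?_
    rw [← X.right_cont a]
    refine measure_mono fun ω hω => ?_
    change ω 0 ∈ A
    rw [hω.2]; exact ha
  · rw [Set.indicator_of_notMem ha]
    have hm : MeasurableSet {ω : ℝ≥0 → Ω | ω 0 ∈ A} := measurable_pi_apply 0 hA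
    rw [← prob_compl_eq_one_iff hm]
    refine le_antisymm prob_le_one ?_
    rw [← X.right_cont a]
    refine measure_mono fun ω hω => ?_
    change ¬ ω 0 ∈ A
    rw [hω.2]; exact ha

theorem eval_preserving (t : ℝ≥0) :
    MeasurePreserving (fun ω : ℝ≥0 → Ω => ω t) X.pathLaw μ := by
  refine ⟨measurable_pi_apply t, Measure.ext fun A hA => ?_⟩
  have hm : MeasurableSet {ω : ℝ≥0 → Ω | ω t ∈ A} := measurable_pi_apply t hA
  rw [Measure.map_apply (measurable_pi_apply t) hA, pathLaw]
  change (μ.bind X.P) {ω : ℝ≥0 → Ω | ω t ∈ A} = μ A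
  rw [Measure.bind_apply hm X.P.measurable.aemeasurable]
  rcases eq_or_lt_of_le (show 0 ≤ t from zero_le) with rfl | ht
  · simp_rw [X.prob_initial _ hA]
    rw [lintegral_indicator_one hA]
  · exact X.invariant t ht A hA

/-- `g ↦ g(ω_t)`, as an isometry from `L²(Ω, μ)` into `L²` of the path space. -/
def evalL2 (t : ℝ≥0) : Lp ℂ 2 μ →L[ℂ] Lp ℂ 2 X.pathLaw :=
  (Lp.compMeasurePreservingₗᵢ ℂ (fun ω : ℝ≥0 → Ω => ω t) (X.eval_preserving t)).toContinuousLinearMap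

/-- The backward semigroup `S_t^†` on `L²(Ω, μ)`, the adjoint of `S_t f(a) = E_a f(ω_t)`; it is
determined by `⟨g, S_t^† f⟩ = ∫ E_a (conj (g(ω_t)) f(ω_0)) dμ(a)` for all `g`. -/
def adjSemigroup (t : ℝ≥0) : Lp ℂ 2 μ →L[ℂ] Lp ℂ 2 μ :=
  (ContinuousLinearMap.adjoint (X.evalL2 t)).comp (X.evalL2 0)

/-- The Markov generator `B f = lim_{t ↓ 0} t⁻¹ (f - S_t^† f)` in `L²(Ω, μ)`. -/
def B : Lp ℂ 2 μ →ₗ.[ℂ] Lp ℂ 2 μ := generator X.adjSemigroup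

/-- The gap condition with time constant `T`, on the mean zero part of the domain of `B`. -/
def HasGap (T : ℝ) : Prop :=
  ∀ f : X.B.domain, ∫ ω, (f : Lp ℂ 2 μ) ω ∂μ = 0 →
    1 / T * ‖(f : Lp ℂ 2 μ)‖ ^ 2 ≤ (⟪(f : Lp ℂ 2 μ), X.B f⟫_ℂ).re

/-- Sectoriality of `B` on the mean zero part of its domain: the numerical range (the values at
unit vectors) satisfies `|Im w| ≤ q |Re w + b|`. -/
def IsSectorial (q b : ℝ) : Prop :=
  ∀ f : X.B.domain, ∫ ω, (f : Lp ℂ 2 μ) ω ∂μ = 0 → ‖(f : Lp ℂ 2 μ)‖ = 1 →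
    |(⟪(f : Lp ℂ 2 μ), X.B f⟫_ℂ).im| ≤ q * |(⟪(f : Lp ℂ 2 μ), X.B f⟫_ℂ).re + b|

/-- The non-degeneracy condition `‖B⁻¹ (v_x - v_0)‖ ≥ χ` for `x ≠ 0`, where `v_x = v ∘ σ_x` and
`B⁻¹` is the inverse of `B` on the mean zero functions. -/
def PotentialNondegenerate (v : Ω → ℝ) (χ : ℝ) : Prop :=
  ∀ x : Fin d → ℤ, x ≠ 0 → ∀ u : X.B.domain, ∫ ω, (u : Lp ℂ 2 μ) ω ∂μ = 0 →
    (X.B u =ᵐ[μ] fun ω => ((v (X.σ x ω) - v (X.σ 0 ω) : ℝ) : ℂ)) → χ ≤ ‖(u : Lp ℂ 2 μ)‖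

/-- `f ↦ f ∘ σ_ζ` on `L²(Ω, μ)`. -/
def shiftL2 (ζ : Fin d → ℤ) : Lp ℂ 2 μ →L[ℂ] Lp ℂ 2 μ :=
  (Lp.compMeasurePreservingₗᵢ ℂ (X.σ ζ) (X.σ_preserving ζ)).toContinuousLinearMap

/-- The hopping term
`K̂_z φ(x, ω) = ∑_ζ h(ζ) [φ(x - ζ, ω) - e^{-i z·ζ} φ(x - ζ, σ_ζ ω)]`. -/
def hopping (k : HoppingKernel d) (z : Fin d → ℂ) : AugSpace d μ →L[ℂ] AugSpace d μ :=
  ∑' ζ : Fin d → ℤ, k.h ζ • (translate ζ (ContinuousLinearMap.id ℂ (Lp ℂ 2 μ)) -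
    Complex.exp (-Complex.I * ∑ i, z i * (ζ i : ℂ)) • translate ζ (X.shiftL2 ζ))

theorem memLp_ofReal_shift {v : Ω → ℝ} (hv : MemLp v ∞ μ) (x : Fin d → ℤ) :
    MemLp (fun ω => ((v (X.σ x ω) : ℝ) : ℂ)) ∞ μ :=
  (hv.comp_measurePreserving (X.σ_preserving x)).ofReal

/-- The function `v_x = v ∘ σ_x` as an element of `L^∞(Ω, μ; ℂ)`. -/
def potentialAt {v : Ω → ℝ} (hv : MemLp v ∞ μ) (x : Fin d → ℤ) : Lp ℂ ∞ μ :=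
  (X.memLp_ofReal_shift hv x).toLp _

theorem norm_potentialAt {v : Ω → ℝ} (hv : MemLp v ∞ μ) (x : Fin d → ℤ) :
    ‖X.potentialAt hv x‖ ≤ ‖hv.toLp v‖ := by
  rw [potentialAt, Lp.norm_toLp, Lp.norm_toLp,
    ← eLpNorm_comp_measurePreserving hv.1 (X.σ_preserving x)]
  refine ENNReal.toReal_mono ?_ (eLpNorm_mono fun ω => by simp)
  exact (hv.comp_measurePreserving (X.σ_preserving x)).2.ne

/-- The potential term `V̂ φ(x, ω) = (v_x(ω) - v_0(ω)) φ(x, ω)`. -/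
def potential {v : Ω → ℝ} (hv : MemLp v ∞ μ) : AugSpace d μ →L[ℂ] AugSpace d μ :=
  blockOp (Equiv.refl _) (fun x => mulL2 (X.potentialAt hv x - X.potentialAt hv 0))
    (‖hv.toLp v‖ + ‖hv.toLp v‖) (fun x => (norm_mulL2_le _).trans ((norm_sub_le _ _).trans
      (add_le_add (X.norm_potentialAt hv x) (X.norm_potentialAt hv 0))))

/-- The operator `L̂_z = i K̂_z + i V̂ + B` on the domain of (the ampliation of) `B`. -/
def L (k : HoppingKernel d) {v : Ω → ℝ} (hv : MemLp v ∞ μ) (z : Fin d → ℂ) :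
    AugSpace d μ →ₗ.[ℂ] AugSpace d μ :=
  (Complex.I • X.hopping k z + Complex.I • X.potential hv : AugSpace d μ →L[ℂ] AugSpace d μ).toLinearMap
    +ᵥ ampliation (Fin d → ℤ) X.B

end Environment

/-- The truncated sector `{w : Re w ≥ γ / T, |Im w| ≤ p (Re w + c)}`. -/
def truncatedSector (T γ p c : ℝ) : Set ℂ :=
  {w | γ / T ≤ w.re ∧ |w.im| ≤ p * (w.re + c)}

end MarkovAnderson

end

open MarkovAnderson

open MeasureTheory ProbabilityTheory Filter Topology
open scoped NNReal ENNReal InnerProductSpace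

noncomputable section

namespace MarkovAnderson

/-! ### Resolvents of partially defined operators -/

section Resolvents

variable {E : Type*} [NormedAddCommGroup E] [NormedSpace ℂ E]

/-! The operator is `iA + 1 ⊗ B` with `A = K̂ + V̂` bounded and symmetric. Split `x = η + Px`, where
`P` projects each site onto the constants. The gap of `B` gives `Re⟪x, L x⟫ ≥ ‖η‖² / T`, since `iA`
contributes no real part; it says nothing about `Px`.

The missing control of `Px` comes from the coupling. Hopping annihilates `Px`, and the potential
sends `c_i ⊗ 1` to `c_i g_i` with `g_i = v_i - v_0` of mean zero. If `(L - w) x = f` and `B u_i =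
g_i`, then at site `i` the vector `B (η_i + i c_i u_i)` is the mean zero part of `w η_i - i (A η)_i
+ f_i`. The gap of `B` bounds `η_i + i c_i u_i`, and `‖u_i‖ ≥ χ` then bounds `c_i` for `i ≠ 0`; the
coefficient `c_0` vanishes on the complement of `δ₀ ⊗ 1`. This is `IsCoupling.norm_alongPart_le`.
Together with the accretivity estimate it yields a lower bound for `L - w` on bounded sets of `w`
with `Re w ≤ γ / T`, for small `γ`.

For large `w` outside a sector, sectoriality gives `‖(B - w) x‖ ≥ ε |w| ‖x‖`, which absorbs the
bounded `A`. Hence `L - w` is bounded below by a multiple of `1 + |w|` off a truncated sector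
(`IsCoupling.exists_norm_sub_smul_ge`).

Lower bounds become resolvents by continuation. The Laplace transform of `S_t†` inverts `B + a`, a
Neumann series inverts `L + a` for `a > ‖A‖`, and `exists_isResolvent_of_convex` propagates
invertibility. On the line of `δ₀ ⊗ 1` the resolvent is `-1/w`. That `S_t†` is a strongly continuous
contraction semigroup is derived from the path measures: the Markov property gives the semigroup
law, right continuity with stationarity gives strong continuity. -/

theorem isResolvent_iff_graph {A : E →ₗ.[ℂ] E} {w : ℂ} {R : E →L[ℂ] E} :
    IsResolvent A w R ↔ (∀ y, (R y, y + w • R y) ∈ A.graph) ∧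
      ∀ x z, (x, z) ∈ A.graph → R (z - w • x) = x := by
  constructor
  · rintro ⟨h₁, h₂⟩
    refine ⟨fun y => ?_, fun x z hxz => ?_⟩
    · obtain ⟨hy, h⟩ := h₁ y
      rw [sub_eq_iff_eq_add] at h
      rw [← h]
      exact A.mem_graph ⟨R y, hy⟩
    · obtain ⟨y, hy, hz⟩ := (A.mem_graph_iff).1 hxz
      simp only at hy hz
      rw [← hy, ← hz]
      exact h₂ y
  · rintro ⟨h₁, h₂⟩
    refine ⟨fun y => ?_, fun x => h₂ _ _ (A.mem_graph x)⟩
    obtain ⟨u, hu, hz⟩ := (A.mem_graph_iff).1 (h₁ y)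
    simp only at hu hz
    refine ⟨hu ▸ u.2, ?_⟩
    rw [sub_eq_iff_eq_add, ← hz]
    congr 1
    exact Subtype.ext hu.symm

theorem mem_vadd_graph {A : E →ₗ.[ℂ] E} {D : E →ₗ[ℂ] E} {x z : E} :
    (x, z) ∈ (D +ᵥ A).graph ↔ (x, z - D x) ∈ A.graph := by
  simp only [LinearPMap.mem_graph_iff]
  constructor
  · rintro ⟨y, rfl, h⟩
    exact ⟨y, rfl, by rw [LinearPMap.vadd_apply] at h; rw [← h]; simp⟩
  · rintro ⟨y, rfl, h⟩
    exact ⟨y, rfl, by rw [LinearPMap.vadd_apply, h]; simp⟩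

theorem IsResolvent.norm_le {A : E →ₗ.[ℂ] E} {w : ℂ} {R : E →L[ℂ] E} (hR : IsResolvent A w R)
    {m : ℝ} (hm : 0 < m) (h : ∀ x z, (x, z) ∈ A.graph → m * ‖x‖ ≤ ‖z - w • x‖) :
    ‖R‖ ≤ 1 / m := by
  refine R.opNorm_le_bound (by positivity) fun y => ?_
  have := h _ _ ((isResolvent_iff_graph.1 hR).1 y)
  rw [add_sub_cancel_right] at this
  rw [one_div_mul_eq_div, le_div_iff₀ hm, mul_comm]
  exact this

/-- Bounded perturbation of the resolvent by a Neumann series. -/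
theorem IsResolvent.perturb [CompleteSpace E] {A : E →ₗ.[ℂ] E} {w : ℂ} {R : E →L[ℂ] E}
    (hR : IsResolvent A w R) (D : E →L[ℂ] E) (hD : ‖D‖ * ‖R‖ < 1) :
    ∃ R', IsResolvent (D.toLinearMap +ᵥ A) w R' := by
  have hlt : ‖-(D * R)‖ < 1 := by
    rw [norm_neg]
    exact (norm_mul_le D R).trans_lt hD
  obtain ⟨u, hu⟩ := isUnit_one_sub_of_norm_lt_one hlt
  rw [sub_neg_eq_add] at hu
  rw [isResolvent_iff_graph] at hR
  -- On the domain of `A` one has `D + A - w = (1 + D R) (A - w)`, so the inverse is `R (1 + D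
  -- R)⁻¹`.
  refine ⟨R * (↑u⁻¹ : E →L[ℂ] E), isResolvent_iff_graph.2 ⟨fun y => ?_, fun x z hxz => ?_⟩⟩
  · have h1 : (1 + D * R) ((↑u⁻¹ : E →L[ℂ] E) y) = y := by
      rw [← hu, ← mul_apply_eq_comp, u.mul_inv, one_apply_eq_self]
    rw [mem_vadd_graph, mul_apply_eq_comp]
    convert hR.1 ((↑u⁻¹ : E →L[ℂ] E) y) using 2
    nth_rewrite 1 [← h1]
    simp only [add_apply, one_apply_eq_self,
      mul_apply_eq_comp, ContinuousLinearMap.coe_coe]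
    abel
  · rw [mem_vadd_graph] at hxz
    set y := z - D.toLinearMap x - w • x with hy
    have hx : R y = x := hR.2 _ _ hxz
    have hz : z - w • x = (1 + D * R) y := by
      simp only [add_apply, one_apply_eq_self,
        mul_apply_eq_comp, hx]
      simp only [hy, ContinuousLinearMap.coe_coe]
      abel
    rw [mul_apply_eq_comp, hz, ← hu, ← mul_apply_eq_comp (↑u⁻¹ : E →L[ℂ] E),
      u.inv_mul, one_apply_eq_self, hx]

/-- Moving the spectral parameter is a bounded perturbation by the scalar `w - w'`. -/
theorem IsResolvent.exists_of_norm_sub_lt [CompleteSpace E] {A : E →ₗ.[ℂ] E} {w w' : ℂ}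
    {R : E →L[ℂ] E} (hR : IsResolvent A w R) (h : ‖w - w'‖ * ‖R‖ < 1) :
    ∃ R', IsResolvent A w' R' := by
  obtain ⟨R', hR'⟩ := hR.perturb ((w - w') • ContinuousLinearMap.id ℂ E) (by
    refine lt_of_le_of_lt ?_ h
    gcongr
    rw [norm_smul]
    exact mul_le_of_le_one_right (norm_nonneg _) ContinuousLinearMap.norm_id_le)
  refine ⟨R', ?_⟩
  rw [isResolvent_iff_graph] at hR' ⊢
  refine ⟨fun y => ?_, fun x z hxz => ?_⟩
  · have := hR'.1 y
    rw [mem_vadd_graph] at this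
    convert this using 2
    change y + w' • R' y = y + w • R' y - (w - w') • R' y
    rw [sub_smul]
    abel
  · have h := hR'.2 x (z + (w - w') • x) (by rw [mem_vadd_graph]; simpa using hxz)
    rwa [show z + (w - w') • x - w • x = z - w' • x by rw [sub_smul]; abel] at h

/-- On a convex set where `A - w` is uniformly bounded below, the existence of the resolvent
propagates from one point to all points. -/
theorem exists_isResolvent_of_convex [CompleteSpace E] {A : E →ₗ.[ℂ] E} {S : Set ℂ}
    (hS : Convex ℝ S) {m : ℝ} (hm : 0 < m)
    (hA : ∀ w ∈ S, ∀ x z, (x, z) ∈ A.graph → m * ‖x‖ ≤ ‖z - w • x‖)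
    {w₀ w₁ : ℂ} (h₀ : w₀ ∈ S) (h₁ : w₁ ∈ S) (hR : ∃ R, IsResolvent A w₀ R) :
    ∃ R, IsResolvent A w₁ R := by
  -- With `n` equal steps each one is shorter than `m ≤ 1 / ‖R‖`, so the Neumann series applies at
  -- every step.
  obtain ⟨n, hn⟩ := exists_nat_gt (‖w₀ - w₁‖ / m)
  have hn0 : (0 : ℝ) < n := lt_of_le_of_lt (by positivity) hn
  let u : ℕ → ℂ := fun j => AffineMap.lineMap w₀ w₁ ((j : ℝ) / n)
  have hu : ∀ j ≤ n, u j ∈ S := fun j hj =>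
    hS.segment_subset h₀ h₁ (by
      rw [segment_eq_image_lineMap]
      exact ⟨_, ⟨by positivity, (div_le_one hn0).2 (by exact_mod_cast hj)⟩, rfl⟩)
  have key : ∀ j ≤ n, ∃ R, IsResolvent A (u j) R := by
    intro j
    induction j with
    | zero => intro _; simpa [u] using hR
    | succ j ih =>
      intro hj
      obtain ⟨R, hR⟩ := ih (by omega)
      refine hR.exists_of_norm_sub_lt ?_
      have hRn := hR.norm_le hm (hA _ (hu j (by omega)))
      have hd : ‖u j - u (j + 1)‖ = ‖w₀ - w₁‖ / n := by
        have : u j - u (j + 1) = ((1 / n : ℝ) : ℂ) * (w₀ - w₁) := by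
          simp only [u, AffineMap.lineMap_apply, vsub_eq_sub, vadd_eq_add, Complex.real_smul]
          push_cast
          ring
        rw [this, norm_mul, Complex.norm_real, Real.norm_of_nonneg (by positivity)]
        ring
      rw [hd]
      calc ‖w₀ - w₁‖ / n * ‖R‖ ≤ ‖w₀ - w₁‖ / n * (1 / m) := by gcongr
        _ = (‖w₀ - w₁‖ / m) / n := by ring
        _ < 1 := (div_lt_one hn0).2 hn
  have := key n le_rfl
  simpa [u, div_self hn0.ne'] using this

/-- A resolvent that leaves `M` invariant induces a resolvent of the operator induced in `M`. -/
theorem IsResolvent.restrictTo {A : E →ₗ.[ℂ] E} {w : ℂ} {R : E →L[ℂ] E} (hR : IsResolvent A w R)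
    (M : Submodule ℂ E) (hM : ∀ y ∈ M, R y ∈ M) :
    ∃ R', IsResolvent (restrictTo A M) w R' := by
  rw [isResolvent_iff_graph] at hR
  refine ⟨(R.comp M.subtypeL).codRestrict M fun y => hM y y.2,
    isResolvent_iff_graph.2 ⟨fun y => ?_, fun x z hxz => ?_⟩⟩
  · rw [mem_restrictTo_graph]
    exact hR.1 y
  · rw [mem_restrictTo_graph] at hxz
    exact Subtype.ext (hR.2 _ _ hxz)

theorem IsResolvent.ampliation (ι : Type*) {B : E →ₗ.[ℂ] E} {w : ℂ} {R : E →L[ℂ] E}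
    (hR : IsResolvent B w R) :
    IsResolvent (ampliation ι B) w (blockOp (Equiv.refl ι) (fun _ => R) ‖R‖ fun _ => le_rfl) := by
  rw [isResolvent_iff_graph] at hR ⊢
  refine ⟨fun y => ?_, fun x z hxz => ?_⟩
  · rw [mem_ampliation_graph]
    exact fun i => hR.1 (y i)
  · rw [mem_ampliation_graph] at hxz
    ext i : 2
    exact hR.2 _ _ (hxz i)

end Resolvents

/-! ### Accretive operators on a Hilbert space -/

section Accretive

variable {E : Type*} [NormedAddCommGroup E] [InnerProductSpace ℂ E]

/-- Cauchy–Schwarz applied to `Re⟪x, z - w x⟫`. -/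
theorem norm_sub_smul_ge_of_re_inner {x z : E} {a : ℝ} {w : ℂ}
    (h : a * ‖x‖ ^ 2 ≤ (⟪x, z⟫_ℂ).re) : (a - w.re) * ‖x‖ ≤ ‖z - w • x‖ := by
  rcases eq_or_ne x 0 with rfl | hx
  · simp
  have hx' : 0 < ‖x‖ := norm_pos_iff.2 hx
  have h1 : (a - w.re) * ‖x‖ ^ 2 ≤ (⟪x, z - w • x⟫_ℂ).re := by
    rw [inner_sub_right, inner_smul_right, inner_self_eq_norm_sq_to_K, Complex.sub_re]
    have : (w * ((‖x‖ : ℝ) : ℂ) ^ 2).re = w.re * ‖x‖ ^ 2 := by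
      rw [← Complex.ofReal_pow, Complex.re_mul_ofReal]
    erw [this]
    linarith
  have h2 : (⟪x, z - w • x⟫_ℂ).re ≤ ‖x‖ * ‖z - w • x‖ :=
    (Complex.re_le_norm _).trans (norm_inner_le_norm _ _)
  refine le_of_mul_le_mul_left ?_ hx'
  linarith

/-- An accretive operator for which `A + a` is onto for some `a > 0` is densely defined. -/
theorem dense_domain_of_accretive [CompleteSpace E] {A : E →ₗ.[ℂ] E}
    (hA : ∀ x z, (x, z) ∈ A.graph → 0 ≤ (⟪x, z⟫_ℂ).re) {a : ℝ} (ha : 0 < a) {R : E →L[ℂ] E}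
    (hR : IsResolvent A (-a : ℂ) R) : Dense (A.domain : Set E) := by
  rw [Submodule.dense_iff_topologicalClosure_eq_top, Submodule.topologicalClosure_eq_top_iff,
    Submodule.eq_bot_iff]
  intro g hg
  -- For `g` orthogonal to the domain, accretivity at `R g` reads `0 ≤ -a ‖R g‖²`. So `R g = 0`, and
  -- the graph then contains `(0, g)`.
  have hmem := (isResolvent_iff_graph.1 hR).1 g
  have h0 : ⟪R g, g⟫_ℂ = 0 := (Submodule.mem_orthogonal _ _).1 hg _
    (LinearPMap.mem_domain_of_mem_graph hmem)
  have h1 := hA _ _ hmem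
  rw [inner_add_right, h0, zero_add, inner_smul_right, inner_self_eq_norm_sq_to_K] at h1
  have : ((-a : ℂ) * ((‖R g‖ : ℝ) : ℂ) ^ 2).re = -a * ‖R g‖ ^ 2 := by
    rw [← Complex.ofReal_pow, ← Complex.ofReal_neg, ← Complex.ofReal_mul, Complex.ofReal_re]
  erw [this] at h1
  have hz : R g = 0 := by
    by_contra hne
    have : 0 < ‖R g‖ := norm_pos_iff.2 hne
    have : 0 < a * ‖R g‖ ^ 2 := by positivity
    linarith
  rw [hz, smul_zero, add_zero] at hmem
  exact A.graph_fst_eq_zero_snd hmem rfl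

end Accretive

/-! ### Contraction semigroups -/

/-- A strongly continuous semigroup of contractions. -/
structure IsContractionSemigroup {E : Type*} [NormedAddCommGroup E] [NormedSpace ℂ E]
    (S : ℝ≥0 → E →L[ℂ] E) : Prop where
  map_zero : ∀ x, S 0 x = x
  map_add : ∀ s t x, S (s + t) x = S s (S t x)
  norm_le : ∀ t x, ‖S t x‖ ≤ ‖x‖
  tendsto : ∀ x, Tendsto (fun t => S t x) (𝓝[>] 0) (𝓝 x)

namespace IsContractionSemigroup

section Banach

variable {E : Type*} [NormedAddCommGroup E] [NormedSpace ℂ E] {S : ℝ≥0 → E →L[ℂ] E}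

/-- Factor out `S` at the smaller time, a contraction: right continuity at `0` thereby yields
two-sided continuity at every time. -/
theorem norm_sub_le (hS : IsContractionSemigroup S) (x : E) (s t : ℝ≥0) :
    ‖S s x - S t x‖ ≤ ‖S (nndist s t) x - x‖ := by
  wlog h : t ≤ s generalizing s t
  · rw [norm_sub_rev, nndist_comm]
    exact this t s (le_of_not_ge h)
  have hd : s = t + nndist s t := by
    rw [NNReal.nndist_eq, tsub_eq_zero_of_le h, max_eq_left zero_le, add_tsub_cancel_of_le h]
  nth_rewrite 1 [hd]
  rw [hS.map_add, ← map_sub]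
  exact hS.norm_le _ _

theorem continuous (hS : IsContractionSemigroup S) (x : E) : Continuous fun t => S t x := by
  have h0 : Tendsto (fun t => S t x) (𝓝 0) (𝓝 x) := by
    rw [← nhdsWithin_univ, show (Set.univ : Set ℝ≥0) = insert 0 (Set.Ioi 0) by
      ext t; simp, nhdsWithin_insert]
    refine Tendsto.sup ?_ (hS.tendsto x)
    have := tendsto_pure_nhds (fun t => S t x) (0 : ℝ≥0)
    rwa [hS.map_zero] at this
  refine continuous_iff_continuousAt.2 fun t => ?_
  refine tendsto_iff_norm_sub_tendsto_zero.2 ?_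
  refine squeeze_zero (fun _ => norm_nonneg _) (fun s => hS.norm_sub_le x s t) ?_
  have h1 : Tendsto (fun s : ℝ≥0 => nndist s t) (𝓝 t) (𝓝 0) := by
    have : Continuous fun s : ℝ≥0 => nndist s t := by fun_prop
    simpa using this.tendsto t
  have h2 := tendsto_iff_norm_sub_tendsto_zero.1 h0
  exact h2.comp h1

/-- The integrand `s ↦ e^{-as} S_s x` of the Laplace transform. -/
def laplaceIntegrand (S : ℝ≥0 → E →L[ℂ] E) (a : ℝ) (x : E) (s : ℝ) : E :=
  ((Real.exp (-a * s) : ℝ) : ℂ) • S s.toNNReal x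

theorem continuous_laplaceIntegrand (hS : IsContractionSemigroup S) (a : ℝ) (x : E) :
    Continuous (laplaceIntegrand S a x) := by
  have := (hS.continuous x).comp continuous_real_toNNReal
  unfold laplaceIntegrand
  exact (by fun_prop : Continuous fun s : ℝ => ((Real.exp (-a * s) : ℝ) : ℂ)).smul this

theorem norm_laplaceIntegrand_le (hS : IsContractionSemigroup S) (a : ℝ) (x : E) (s : ℝ) :
    ‖laplaceIntegrand S a x s‖ ≤ Real.exp (-a * s) * ‖x‖ := by
  rw [laplaceIntegrand, norm_smul, Complex.norm_real, Real.norm_of_nonneg (Real.exp_pos _).le]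
  exact mul_le_mul_of_nonneg_left (hS.norm_le _ _) (Real.exp_pos _).le

theorem integrableOn_laplaceIntegrand (hS : IsContractionSemigroup S) {a : ℝ} (ha : 0 < a) (x : E) :
    IntegrableOn (laplaceIntegrand S a x) (Set.Ioi 0) :=
  ((exp_neg_integrableOn_Ioi 0 ha).mul_const ‖x‖).mono'
    (hS.continuous_laplaceIntegrand a x).aestronglyMeasurable
    (ae_of_all _ (hS.norm_laplaceIntegrand_le a x))

/-- The Laplace transform `∫₀^∞ e^{-as} S_s ds` of a contraction semigroup. -/
def laplace (hS : IsContractionSemigroup S) {a : ℝ} (ha : 0 < a) : E →L[ℂ] E :=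
  LinearMap.mkContinuous
    { toFun := fun x => ∫ s in Set.Ioi 0, laplaceIntegrand S a x s
      map_add' := fun x y => by
        rw [← integral_add (hS.integrableOn_laplaceIntegrand ha x)
          (hS.integrableOn_laplaceIntegrand ha y)]
        simp [laplaceIntegrand]
      map_smul' := fun c x => by
        rw [RingHom.id_apply, ← integral_smul]
        simp only [laplaceIntegrand, map_smul, smul_comm c] }
    (1 / a) (fun x => by
      have h := norm_integral_le_of_norm_le ((exp_neg_integrableOn_Ioi 0 ha).mul_const ‖x‖)
        (ae_of_all _ (hS.norm_laplaceIntegrand_le a x))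
      refine h.trans (le_of_eq ?_)
      rw [integral_mul_const, integral_exp_mul_Ioi (neg_lt_zero.2 ha)]
      simp)

theorem laplace_apply (hS : IsContractionSemigroup S) {a : ℝ} (ha : 0 < a) (x : E) :
    hS.laplace ha x = ∫ s in Set.Ioi 0, laplaceIntegrand S a x s := rfl

/-- Applying `S t` shifts the integration variable, which turns the integral over `(0, ∞)` into
`e^{at}` times the one over `(t, ∞)`. The orbit of a Laplace transform is thus explicitly
differentiable in `t`. -/
theorem apply_laplace [CompleteSpace E] (hS : IsContractionSemigroup S) {a : ℝ} (ha : 0 < a) (x : E)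
    (t : ℝ≥0) :
    S t (hS.laplace ha x) = ((Real.exp (a * t) : ℝ) : ℂ) •
      (hS.laplace ha x - ∫ s in (0 : ℝ)..t, laplaceIntegrand S a x s) := by
  have hint := hS.integrableOn_laplaceIntegrand ha x
  have hpre : (fun s : ℝ => s + t) ⁻¹' Set.Ioi (t : ℝ) = Set.Ioi 0 := by
    ext s; simp
  have htr := (measurePreserving_add_right volume (t : ℝ)).setIntegral_preimage_emb
    (measurableEmbedding_addRight _) (laplaceIntegrand S a x) (Set.Ioi (t : ℝ))
  rw [hpre] at htr
  rw [laplace_apply, ← intervalIntegral.integral_Ioi_sub_Ioi hint t.coe_nonneg, sub_sub_cancel,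
    ← ContinuousLinearMap.integral_comp_comm _ hint, ← htr, ← integral_smul]
  refine setIntegral_congr_fun measurableSet_Ioi fun s hs => ?_
  have hs' : (0 : ℝ) ≤ s := le_of_lt hs
  simp only [laplaceIntegrand, map_smul, smul_smul]
  rw [← hS.map_add, Real.toNNReal_add hs' t.coe_nonneg, Real.toNNReal_coe, add_comm t, ← Complex.ofReal_mul,
    ← Real.exp_add]
  congr 3
  ring_nf

theorem laplace_mem_graph [CompleteSpace E] (hS : IsContractionSemigroup S) {a : ℝ} (ha : 0 < a)
    (x : E) :
    (hS.laplace ha x, x + (-a : ℂ) • hS.laplace ha x) ∈ (generator S).graph := by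
  rw [mem_generator_graph]
  set y := hS.laplace ha x with hy
  let H : ℝ → E := fun t => ((Real.exp (a * t) : ℝ) : ℂ) •
      (y - ∫ s in (0 : ℝ)..t, laplaceIntegrand S a x s)
  have h1 : HasDerivAt (fun t => ∫ s in (0 : ℝ)..t, laplaceIntegrand S a x s) x 0 := by
    have hc := hS.continuous_laplaceIntegrand a x
    have := intervalIntegral.integral_hasDerivAt_right (hc.intervalIntegrable 0 0)
      (hc.stronglyMeasurableAtFilter _ _) hc.continuousAt
    simpa [laplaceIntegrand, hS.map_zero] using this
  have h2 : HasDerivAt (fun t : ℝ => ((Real.exp (a * t) : ℝ) : ℂ)) (a : ℂ) 0 := by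
    have := ((hasDerivAt_id (0 : ℝ)).const_mul a).exp
    simpa using this.ofReal_comp
  -- `H` is the orbit `t ↦ S t y` for `t ≥ 0`; the sign convention of the generator takes minus its
  -- derivative at `0`.
  have h3 : HasDerivAt H ((a : ℂ) • y - x) 0 := by
    have := h2.smul (h1.const_sub y)
    simp only [mul_zero, Real.exp_zero, Complex.ofReal_one, one_smul,
      intervalIntegral.integral_same, sub_zero] at this
    rwa [neg_add_eq_sub] at this
  have h4 := h3.tendsto_slope_zero_right.neg
  have h5 : Tendsto (fun t : ℝ≥0 => (t : ℝ)) (𝓝[>] 0) (𝓝[>] 0) :=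
    tendsto_nhdsWithin_iff.2 ⟨(NNReal.continuous_coe.tendsto' 0 0 rfl).mono_left nhdsWithin_le_nhds,
      eventually_mem_nhdsWithin.mono fun t ht => by simpa using ht⟩
  have h6 := h4.comp h5
  rw [neg_sub] at h6
  rw [neg_smul, ← sub_eq_add_neg]
  refine h6.congr fun t => ?_
  have hH0 : H 0 = y := by simp [H]
  simp only [Function.comp_apply, zero_add, hH0]
  rw [hS.apply_laplace ha x t, ← smul_neg, neg_sub, ← Complex.ofReal_inv, Complex.coe_smul]

end Banach

/-! ### Accretivity and resolvent of the generator on a Hilbert space -/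

section Hilbert

variable {E : Type*} [NormedAddCommGroup E] [InnerProductSpace ℂ E] {S : ℝ≥0 → E →L[ℂ] E}

theorem re_inner_generator_nonneg (hS : IsContractionSemigroup S) {x z : E}
    (h : (x, z) ∈ (generator S).graph) : 0 ≤ (⟪x, z⟫_ℂ).re := by
  rw [mem_generator_graph] at h
  have h1 : Tendsto (fun t : ℝ≥0 => (⟪x, ((t : ℝ) : ℂ)⁻¹ • (x - S t x)⟫_ℂ).re) (𝓝[>] 0)
      (𝓝 (⟪x, z⟫_ℂ).re) :=
    (Complex.continuous_re.tendsto _).comp (tendsto_const_nhds.inner h)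
  refine ge_of_tendsto' h1 fun t => ?_
  rw [inner_smul_right, ← Complex.ofReal_inv, Complex.re_ofReal_mul, inner_sub_right,
    Complex.sub_re]
  refine mul_nonneg (by positivity) (sub_nonneg.2 ?_)
  calc (⟪x, S t x⟫_ℂ).re ≤ ‖x‖ * ‖S t x‖ := (Complex.re_le_norm _).trans (norm_inner_le_norm _ _)
    _ ≤ ‖x‖ * ‖x‖ := by gcongr; exact hS.norm_le _ _
    _ = (⟪x, x⟫_ℂ).re := by rw [← sq]; exact norm_sq_eq_re_inner (𝕜 := ℂ) x

/-- The Laplace transform is a right inverse of `B + a` by differentiation; it is also a left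
inverse because accretivity makes `B + a` injective. -/
theorem isResolvent_laplace [CompleteSpace E] (hS : IsContractionSemigroup S) {a : ℝ} (ha : 0 < a) :
    IsResolvent (generator S) (-a : ℂ) (hS.laplace ha) := by
  refine isResolvent_iff_graph.2 ⟨hS.laplace_mem_graph ha, fun x z hxz => ?_⟩
  have h1 := hS.laplace_mem_graph ha (z - (-a : ℂ) • x)
  have h2 := (generator S).graph.sub_mem h1 hxz
  rw [Prod.mk_sub_mk] at h2
  have h3 := norm_sub_smul_ge_of_re_inner (a := 0) (w := (-a : ℂ)) (by
    rw [zero_mul]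
    exact hS.re_inner_generator_nonneg h2)
  have h4 : z - (-a : ℂ) • x + (-a : ℂ) • hS.laplace ha (z - (-a : ℂ) • x) - z -
      (-a : ℂ) • (hS.laplace ha (z - (-a : ℂ) • x) - x) = 0 := by
    rw [smul_sub]; abel
  rw [h4, norm_zero] at h3
  have h5 : ‖hS.laplace ha (z - (-a : ℂ) • x) - x‖ = 0 := by
    have : (0 - (-a : ℂ).re) = a := by simp
    rw [this] at h3
    nlinarith [norm_nonneg (hS.laplace ha (z - (-a : ℂ) • x) - x)]
  exact sub_eq_zero.1 (norm_eq_zero.1 h5)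

end Hilbert

end IsContractionSemigroup

/-! ### Indicators in `L²` -/

section Indicators

variable {α : Type*} [MeasurableSpace α] {ν : Measure α} [IsFiniteMeasure ν]

/-- The indicator function of a measurable set as an element of `L²`. -/
def indL2 (ν : Measure α) [IsFiniteMeasure ν] {A : Set α} (hA : MeasurableSet A) : Lp ℂ 2 ν :=
  indicatorConstLp 2 hA (measure_ne_top ν A) 1

theorem indL2_mem_induction {W : Submodule ℂ (Lp ℂ 2 ν)} (hW : IsClosed (W : Set (Lp ℂ 2 ν)))
    (h : ∀ (A : Set α) (hA : MeasurableSet A), indL2 ν hA ∈ W) (f : Lp ℂ 2 ν) : f ∈ W := by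
  refine Lp.induction (by simp) (motive := fun f => f ∈ W) ?_ ?_ hW f
  · intro c s hs hμs
    rw [Lp.simpleFunc.coe_indicatorConst]
    have : indicatorConstLp 2 hs hμs.ne c = c • indL2 ν hs := by
      rw [indL2, indicatorConstLp, indicatorConstLp, ← MemLp.toLp_const_smul]
      congr 1
      ext x
      by_cases hx : x ∈ s <;> simp [hx]
    rw [this]
    exact W.smul_mem _ (h s hs)
  · intro f g _ _ _ hf hg
    exact W.add_mem hf hg

theorem ext_inner_indL2 {u v : Lp ℂ 2 ν}
    (h : ∀ (A : Set α) (hA : MeasurableSet A), ⟪indL2 ν hA, u⟫_ℂ = ⟪indL2 ν hA, v⟫_ℂ) : u = v := by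
  have := indL2_mem_induction (W := (ℂ ∙ (u - v))ᗮ) (Submodule.isClosed_orthogonal _)
    (fun A hA => by
      rw [Submodule.mem_orthogonal_singleton_iff_inner_left, inner_sub_right, h, sub_self]) (u - v)
  rw [Submodule.mem_orthogonal_singleton_iff_inner_left, inner_self_eq_zero, sub_eq_zero] at this
  exact this

/-- A closed subspace of `L²` that contains the constants and the indicators of a generating
π-system contains all indicators. -/
theorem indL2_mem_of_piSystem {W : Submodule ℂ (Lp ℂ 2 ν)} (hW : IsClosed (W : Set (Lp ℂ 2 ν)))
    {s : Set (Set α)} (hs : ‹MeasurableSpace α› = MeasurableSpace.generateFrom s)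
    (hpi : IsPiSystem s) (hconst : Lp.const 2 ν (1 : ℂ) ∈ W)
    (h : ∀ (A : Set α) (hA : MeasurableSet A), A ∈ s → indL2 ν hA ∈ W) (A : Set α)
    (hA : MeasurableSet A) : indL2 ν hA ∈ W := by
  have hunion : ∀ (A B : Set α) (hA : MeasurableSet A) (hB : MeasurableSet B), Disjoint A B →
      indL2 ν (hA.union hB) = indL2 ν hA + indL2 ν hB := fun A B hA hB hAB =>
    indicatorConstLp_disjoint_union hA hB (measure_ne_top _ _) (measure_ne_top _ _) hAB 1
  refine MeasurableSpace.induction_on_inter (C := fun A hA => indL2 ν hA ∈ W) hs hpi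
    ?_ ?_ ?_ ?_ A hA
  · rw [indL2, indicatorConstLp_empty]
    exact W.zero_mem
  · intro t ht
    exact h t _ ht
  · intro t ht hmem
    have h1 := hunion t tᶜ ht ht.compl disjoint_compl_right
    have h2 : indL2 ν (ht.union ht.compl) = Lp.const 2 ν 1 := by
      rw [← indicatorConstLp_univ]
      simp only [indL2, Set.union_compl_self]
    rw [h2, ← sub_eq_iff_eq_add'] at h1
    rw [← h1]
    exact W.sub_mem hconst hmem
  · intro f hf hfm hmem
    -- Partial unions are handled by additivity; their indicators converge in `L²` to that of the
    -- full union, and `W` is closed.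
    have hfin : ∀ n, ∀ hm : MeasurableSet (⋃ i < n, f i), indL2 ν hm ∈ W := by
      intro n
      induction n with
      | zero =>
        intro hm
        have : (⋃ i < 0, f i) = ∅ := by simp
        simp only [this, indL2, indicatorConstLp_empty]
        exact W.zero_mem
      | succ n ih =>
        intro hm
        have hm' : MeasurableSet (⋃ i < n, f i) :=
          MeasurableSet.biUnion (Set.to_countable _) fun i _ => hfm i
        have heq : (⋃ i < n + 1, f i) = (⋃ i < n, f i) ∪ f n := Set.biUnion_lt_succ f n
        have hdisj : Disjoint (⋃ i < n, f i) (f n) := by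
          simp only [Set.disjoint_iUnion_left]
          exact fun i hi => hf hi.ne
        have h1 := hunion _ _ hm' (hfm n) hdisj
        have h2 : indL2 ν hm = indL2 ν (hm'.union (hfm n)) := by simp only [heq]
        rw [h2, h1]
        exact W.add_mem (ih hm') (hmem n)
    have hm' : ∀ n, MeasurableSet (⋃ i < n, f i) := fun n =>
      MeasurableSet.biUnion (Set.to_countable _) fun i _ => hfm i
    refine hW.mem_of_tendsto (b := atTop) (f := fun n => indL2 ν (hm' n)) ?_
      (Eventually.of_forall fun n => hfin n _)
    refine tendsto_indicatorConstLp_set (by simp) ?_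
    rw [← measure_empty (μ := ν)]
    refine tendsto_measure_of_ae_tendsto_indicator_of_isFiniteMeasure atTop MeasurableSet.empty
      (fun n => (hm' n).symmDiff (.iUnion hfm)) (ae_of_all _ fun x => ?_)
    by_cases hx : x ∈ ⋃ i, f i
    · obtain ⟨j, hj⟩ := Set.mem_iUnion.1 hx
      filter_upwards [eventually_gt_atTop j] with n hn
      have : x ∈ ⋃ i < n, f i := Set.mem_biUnion (show j ∈ {i | i < n} from hn) hj
      simp only [Set.mem_symmDiff, this, hx, not_true_eq_false, and_false, or_self,
        Set.mem_empty_iff_false]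
    · refine Eventually.of_forall fun n => ?_
      have : x ∉ ⋃ i < n, f i := fun h => hx (by
        obtain ⟨i, _, hi⟩ := Set.mem_iUnion₂.1 h
        exact Set.mem_iUnion_of_mem i hi)
      simp only [Set.mem_symmDiff, this, hx, false_and, or_self, Set.mem_empty_iff_false]

end Indicators

/-! ### The semigroup of the environment -/

theorem measurableSet_eval {Ω : Type*} [MeasurableSpace Ω] (t : ℝ≥0) {A : Set Ω}
    (hA : MeasurableSet A) : MeasurableSet {ω : ℝ≥0 → Ω | ω t ∈ A} :=
  measurable_pi_apply t hA

namespace Environment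

variable {d : ℕ} {Ω : Type*} [MeasurableSpace Ω] {μ : Measure Ω} [TopologicalSpace Ω]

section

variable (X : Environment d μ)

/-- The good paths only have outer measure one. A measurable set containing them has measure one, so
measurability of `p` is what permits the almost sure conclusion. -/
theorem ae_path {a : Ω} {p : (ℝ≥0 → Ω) → Prop} (hp : MeasurableSet {ω | p ω})
    (h : ∀ ω : ℝ≥0 → Ω, (∀ t, ContinuousWithinAt ω (Set.Ici t) t) → ω 0 = a → p ω) :
    ∀ᵐ ω ∂(X.P a), p ω := by
  have := X.isMarkov
  rw [ae_iff]
  change X.P a {ω | p ω}ᶜ = 0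
  rw [prob_compl_eq_zero_iff hp]
  refine le_antisymm prob_le_one ?_
  rw [← X.right_cont a]
  exact measure_mono fun ω hω => h ω hω.1 hω.2

theorem isProbabilityMeasure_pathLaw [IsProbabilityMeasure μ] : IsProbabilityMeasure X.pathLaw :=
  ⟨((X.eval_preserving 0).measure_preimage MeasurableSet.univ.nullMeasurableSet).trans measure_univ⟩

/-- Since `ω 0 = a` almost surely under `P a`, conditioning on the starting point restricts only the
outer integral. -/
theorem setLIntegral_pathLaw {C : Set Ω} (hC : MeasurableSet C) {F : (ℝ≥0 → Ω) → ℝ≥0∞}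
    (hF : Measurable F) :
    ∫⁻ ω in {ω | ω 0 ∈ C}, F ω ∂X.pathLaw = ∫⁻ a in C, ∫⁻ ω, F ω ∂(X.P a) ∂μ := by
  have hm : MeasurableSet {ω : ℝ≥0 → Ω | ω 0 ∈ C} := measurableSet_eval 0 hC
  rw [← lintegral_indicator hm, pathLaw, Measure.lintegral_bind X.P.measurable.aemeasurable
    (hF.indicator hm).aemeasurable, ← lintegral_indicator hC]
  refine lintegral_congr fun a => ?_
  by_cases ha : a ∈ C
  · rw [Set.indicator_of_mem ha]
    refine lintegral_congr_ae ?_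
    filter_upwards [X.ae_path (a := a) (p := fun ω => ω 0 ∈ C) hm fun ω _ h => h ▸ ha] with ω hω
    rw [Set.indicator_of_mem (show ω ∈ {ω : ℝ≥0 → Ω | ω 0 ∈ C} from hω)]
  · rw [Set.indicator_of_notMem ha, ← lintegral_zero (μ := X.P a)]
    refine lintegral_congr_ae ?_
    filter_upwards [X.ae_path (a := a) (p := fun ω => ω 0 ∉ C) hm.compl fun ω _ h => h ▸ ha]
      with ω hω
    rw [Set.indicator_of_notMem (show ω ∉ {ω : ℝ≥0 → Ω | ω 0 ∈ C} from hω)]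

theorem pathLaw_inter {C : Set Ω} (hC : MeasurableSet C) {D : Set (ℝ≥0 → Ω)}
    (hD : MeasurableSet D) :
    X.pathLaw ({ω | ω 0 ∈ C} ∩ D) = ∫⁻ a in C, X.P a D ∂μ := by
  have := X.setLIntegral_pathLaw hC (F := D.indicator 1) (measurable_one.indicator hD)
  rw [lintegral_indicator_one hD, Measure.restrict_apply hD, Set.inter_comm] at this
  rw [this]
  exact lintegral_congr fun a => lintegral_indicator_one hD

theorem norm_evalL2 (t : ℝ≥0) (f : Lp ℂ 2 μ) : ‖X.evalL2 t f‖ = ‖f‖ :=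
  LinearIsometry.norm_map _ f

theorem adjoint_evalL2_apply (t : ℝ≥0) (f : Lp ℂ 2 μ) :
    ContinuousLinearMap.adjoint (X.evalL2 t) (X.evalL2 t f) = f := by
  refine ext_inner_left ℂ fun g => ?_
  rw [ContinuousLinearMap.adjoint_inner_right]
  exact LinearIsometry.inner_map_map _ g f

theorem norm_adjoint_evalL2_le (t : ℝ≥0) (f : Lp ℂ 2 X.pathLaw) :
    ‖ContinuousLinearMap.adjoint (X.evalL2 t) f‖ ≤ ‖f‖ := by
  refine (ContinuousLinearMap.le_of_opNorm_le _ (c := 1) ?_ f).trans (one_mul _).le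
  rw [LinearIsometryEquiv.norm_map]
  exact LinearIsometry.norm_toContinuousLinearMap_le _

/-- The transition probabilities `a ↦ P_a(ω_t ∈ A)`. -/
def transition (t : ℝ≥0) (A : Set Ω) (a : Ω) : ℝ := (X.P a).real {ω | ω t ∈ A}

theorem measurable_transition (t : ℝ≥0) {A : Set Ω} (hA : MeasurableSet A) :
    Measurable (X.transition t A) :=
  (X.P.measurable_coe (measurableSet_eval t hA)).ennreal_toReal

theorem norm_transition_le (t : ℝ≥0) (A : Set Ω) (a : Ω) : ‖X.transition t A a‖ ≤ 1 := by
  have := X.isMarkov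
  rw [transition, Real.norm_of_nonneg measureReal_nonneg]
  exact measureReal_le_one

/-- The forward semigroup `S_t f(a) = E_a f(ω_t)`. -/
def fwdSemigroup (t : ℝ≥0) : Lp ℂ 2 μ →L[ℂ] Lp ℂ 2 μ :=
  (ContinuousLinearMap.adjoint (X.evalL2 0)).comp (X.evalL2 t)

theorem inner_fwdSemigroup (t : ℝ≥0) (f g : Lp ℂ 2 μ) :
    ⟪g, X.fwdSemigroup t f⟫_ℂ = ⟪X.evalL2 0 g, X.evalL2 t f⟫_ℂ :=
  ContinuousLinearMap.adjoint_inner_right (X.evalL2 0) g (X.evalL2 t f)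

theorem fwdSemigroup_zero (f : Lp ℂ 2 μ) : X.fwdSemigroup 0 f = f := X.adjoint_evalL2_apply 0 f

theorem adjoint_fwdSemigroup (t : ℝ≥0) :
    ContinuousLinearMap.adjoint (X.fwdSemigroup t) = X.adjSemigroup t := by
  rw [fwdSemigroup, adjSemigroup, ContinuousLinearMap.adjoint_comp,
    ContinuousLinearMap.adjoint_adjoint]

end

/-! ### Strong continuity and the semigroup law -/

section Probability

variable [IsProbabilityMeasure μ] (X : Environment d μ)

instance : IsProbabilityMeasure X.pathLaw := X.isProbabilityMeasure_pathLaw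

theorem evalL2_indL2 (t : ℝ≥0) {A : Set Ω} (hA : MeasurableSet A) :
    X.evalL2 t (indL2 μ hA) = indL2 X.pathLaw (measurableSet_eval t hA) :=
  rfl

theorem evalL2_const (t : ℝ≥0) (c : ℂ) :
    X.evalL2 t (Lp.const 2 μ c) = Lp.const 2 X.pathLaw c := rfl

/-- For open `U`, a right continuous path that starts in `U` stays there for a while. -/
theorem tendsto_exit [OpensMeasurableSpace Ω] {U : Set Ω} (hU : IsOpen U) :
    Tendsto (fun t : ℝ≥0 => X.pathLaw ({ω | ω 0 ∈ U} ∩ {ω | ω t ∈ U}ᶜ)) (𝓝[>] 0) (𝓝 0) := by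
  have hm : ∀ t : ℝ≥0, MeasurableSet {ω : ℝ≥0 → Ω | ω t ∈ U} := fun t =>
    measurable_pi_apply t hU.measurableSet
  refine tendsto_of_seq_tendsto fun u hu => ?_
  rw [← measure_empty (μ := X.pathLaw)]
  refine tendsto_measure_of_ae_tendsto_indicator_of_isFiniteMeasure atTop MeasurableSet.empty
    (fun n => (hm 0).inter (hm (u n)).compl) ?_
  -- Along a sequence of times the bad event involves countably many coordinates, hence is
  -- measurable, and right continuity excludes it.
  have hmeas : MeasurableSet {ω : ℝ≥0 → Ω | ∃ᶠ n in atTop, ω 0 ∈ U ∧ ω (u n) ∉ U} := by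
    have : {ω : ℝ≥0 → Ω | ∃ᶠ n in atTop, ω 0 ∈ U ∧ ω (u n) ∉ U} =
        ⋂ N : ℕ, ⋃ n : ℕ, ⋃ _ : N ≤ n, {ω | ω 0 ∈ U} ∩ {ω | ω (u n) ∈ U}ᶜ := by
      ext ω
      simp only [Set.mem_ofPred_eq, frequently_atTop, Set.mem_iInter, Set.mem_iUnion,
        Set.mem_inter_iff, Set.mem_compl_iff, exists_prop]
    rw [this]
    exact .iInter fun N => .iUnion fun n => .iUnion fun _ => (hm 0).inter (hm (u n)).compl
  have hz : X.pathLaw {ω : ℝ≥0 → Ω | ∃ᶠ n in atTop, ω 0 ∈ U ∧ ω (u n) ∉ U} = 0 := by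
    rw [pathLaw, Measure.bind_apply hmeas X.P.measurable.aemeasurable, lintegral_eq_zero_iff'
      (X.P.measurable_coe hmeas).aemeasurable]
    refine ae_of_all _ fun a => ?_
    have h1 : ∀ᵐ ω ∂(X.P a), ¬ ∃ᶠ n in atTop, ω 0 ∈ U ∧ ω (u n) ∉ U := by
      refine X.ae_path hmeas.compl fun ω hω _ => ?_
      rw [not_frequently]
      by_cases h0 : ω 0 ∈ U
      · have h2 : Tendsto ω (𝓝[>] 0) (𝓝 (ω 0)) :=
          (hω 0).mono_left (nhdsWithin_mono _ Set.Ioi_subset_Ici_self)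
        filter_upwards [(h2.comp hu).eventually (hU.mem_nhds h0)] with n hn
        exact fun h => h.2 hn
      · exact Eventually.of_forall fun n h => h0 h.1
    simpa only [ae_iff, not_not, Pi.zero_apply] using h1
  have hae : ∀ᵐ ω ∂X.pathLaw, ¬ ∃ᶠ n in atTop, ω 0 ∈ U ∧ ω (u n) ∉ U := by
    simpa only [ae_iff, not_not] using hz
  filter_upwards [hae] with ω hω
  rw [not_frequently] at hω
  filter_upwards [hω] with n hn
  exact ⟨fun h => hn h, fun h => h.elim⟩

/-- The evaluations are isometries, so the `f` with this convergence form a closed subspace. Open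
sets are a π-system generating the Borel sets, so their indicators and the constants suffice. -/
theorem tendsto_evalL2 [BorelSpace Ω] (f : Lp ℂ 2 μ) :
    Tendsto (fun t => X.evalL2 t f) (𝓝[>] 0) (𝓝 (X.evalL2 0 f)) := by
  let W : Submodule ℂ (Lp ℂ 2 μ) :=
    { carrier := {f | Tendsto (fun t => X.evalL2 t f) (𝓝[>] 0) (𝓝 (X.evalL2 0 f))}
      zero_mem' := by
        simp only [Set.mem_ofPred_eq, map_zero]
        exact tendsto_const_nhds
      add_mem' := fun {f g} hf hg => by
        simp only [Set.mem_ofPred_eq, map_add] at hf hg ⊢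
        exact hf.add hg
      smul_mem' := fun c f hf => by
        simp only [Set.mem_ofPred_eq, map_smul] at hf ⊢
        exact hf.const_smul c }
  have hW : IsClosed (W : Set (Lp ℂ 2 μ)) := by
    refine isClosed_of_closure_subset fun f hf => ?_
    refine Metric.tendsto_nhds.2 fun ε hε => ?_
    obtain ⟨g, hg, hfg⟩ := Metric.mem_closure_iff.1 hf (ε / 3) (by positivity)
    filter_upwards [Metric.tendsto_nhds.1 (show Tendsto _ _ _ from hg) (ε / 3) (by positivity)]
      with t ht
    have h1 : ∀ s, dist (X.evalL2 s f) (X.evalL2 s g) = dist f g := fun s => by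
      rw [dist_eq_norm, ← map_sub, norm_evalL2, dist_eq_norm]
    calc dist (X.evalL2 t f) (X.evalL2 0 f)
        ≤ dist (X.evalL2 t f) (X.evalL2 t g) + dist (X.evalL2 t g) (X.evalL2 0 g) +
          dist (X.evalL2 0 g) (X.evalL2 0 f) := dist_triangle4 _ _ _ _
      _ < ε / 3 + ε / 3 + ε / 3 := by
        rw [dist_comm (X.evalL2 0 g), h1, h1]
        gcongr
      _ = ε := by ring
  refine indL2_mem_induction hW (indL2_mem_of_piSystem hW (s := {s | IsOpen s})
    BorelSpace.measurable_eq isPiSystem_isOpen ?_ ?_) f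
  · change Tendsto (fun t => X.evalL2 t _) _ _
    simp only [evalL2_const]
    exact tendsto_const_nhds
  · intro U hUm hU
    change Tendsto (fun t => X.evalL2 t _) _ _
    simp only [evalL2_indL2]
    refine tendsto_indicatorConstLp_set (by simp) ?_
    have hm : ∀ t : ℝ≥0, MeasurableSet {ω : ℝ≥0 → Ω | ω t ∈ U} := fun t =>
      measurable_pi_apply t hUm
    have hμ : ∀ t : ℝ≥0, X.pathLaw {ω : ℝ≥0 → Ω | ω t ∈ U} = μ U := fun t =>
      (X.eval_preserving t).measure_preimage hUm.nullMeasurableSet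
    have hle : ∀ t : ℝ≥0, X.pathLaw (symmDiff {ω : ℝ≥0 → Ω | ω t ∈ U} {ω | ω 0 ∈ U}) ≤
        X.pathLaw ({ω | ω 0 ∈ U} ∩ {ω | ω t ∈ U}ᶜ) + X.pathLaw ({ω | ω 0 ∈ U} ∩ {ω | ω t ∈ U}ᶜ) := by
      intro t
      -- By stationarity entering `U` is as likely as leaving it, so only the exit probability has
      -- to be estimated.
      have heq : X.pathLaw ({ω | ω t ∈ U} \ {ω | ω 0 ∈ U}) =
          X.pathLaw ({ω | ω 0 ∈ U} \ {ω | ω t ∈ U}) := by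
        rw [measure_sdiff' _ (hm 0).nullMeasurableSet (measure_ne_top _ _),
          measure_sdiff' _ (hm t).nullMeasurableSet (measure_ne_top _ _),
          hμ, hμ, Set.union_comm]
      rw [← Set.sdiff_eq]
      refine (measure_union_le _ _).trans (add_le_add heq.le le_rfl)
    have h0 := (X.tendsto_exit hU).add (X.tendsto_exit hU)
    rw [add_zero] at h0
    exact tendsto_of_tendsto_of_tendsto_of_le_of_le tendsto_const_nhds h0 (fun _ => zero_le) hle

theorem memLp_transition (t : ℝ≥0) {A : Set Ω} (hA : MeasurableSet A) :
    MemLp (fun a => (X.transition t A a : ℂ)) 2 μ :=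
  MemLp.of_bound (Complex.measurable_ofReal.comp
    (X.measurable_transition t hA)).aestronglyMeasurable 1
    (ae_of_all _ fun a => by
      rw [Complex.norm_real]
      exact X.norm_transition_le t A a)

theorem inner_evalL2_transition (s t : ℝ≥0) {A C : Set Ω} (hA : MeasurableSet A)
    (hC : MeasurableSet C) :
    ⟪X.evalL2 0 (indL2 μ hC), X.evalL2 s ((X.memLp_transition t hA).toLp _)⟫_ℂ =
      ((∫⁻ a in C, ∫⁻ ω, X.P (ω s) {ω | ω t ∈ A} ∂(X.P a) ∂μ).toReal : ℂ) := by
  have hmA : MeasurableSet {ω : ℝ≥0 → Ω | ω t ∈ A} := measurableSet_eval t hA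
  have hF : Measurable fun ω : ℝ≥0 → Ω => X.P (ω s) {ω | ω t ∈ A} :=
    (X.P.measurable_coe hmA).comp (measurable_pi_apply s)
  have := X.isMarkov
  rw [evalL2_indL2, indL2, L2.inner_indicatorConstLp_one,
    ← X.setLIntegral_pathLaw hC hF, ← integral_toReal hF.aemeasurable
      (ae_of_all _ fun ω => measure_lt_top _ _), ← integral_complex_ofReal]
  refine integral_congr_ae (ae_restrict_of_ae ?_)
  have h1 : X.evalL2 s ((X.memLp_transition t hA).toLp _) =ᵐ[X.pathLaw] _ :=
    Lp.coeFn_compMeasurePreserving _ (X.eval_preserving s)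
  have h2 := (X.eval_preserving s).quasiMeasurePreserving.ae_eq_comp
    (X.memLp_transition t hA).coeFn_toLp
  filter_upwards [h1, h2] with ω h1 h2
  rw [h1, h2]
  rfl

theorem inner_fwdSemigroup_indL2 (t : ℝ≥0) {A C : Set Ω} (hA : MeasurableSet A)
    (hC : MeasurableSet C) :
    ⟪indL2 μ hC, X.fwdSemigroup t (indL2 μ hA)⟫_ℂ =
      ((∫⁻ a in C, X.P a {ω | ω t ∈ A} ∂μ).toReal : ℂ) := by
  rw [inner_fwdSemigroup, evalL2_indL2, evalL2_indL2, indL2, indL2,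
    L2.inner_indicatorConstLp_one_indicatorConstLp_one, Measure.real,
    ← X.pathLaw_inter hC (measurableSet_eval t hA)]
  rfl

/-- Identifies the Hilbert space operator with the transition kernel, so that the pointwise Markov
property can be applied to it. -/
theorem fwdSemigroup_indL2 (t : ℝ≥0) {A : Set Ω} (hA : MeasurableSet A) :
    X.fwdSemigroup t (indL2 μ hA) = (X.memLp_transition t hA).toLp _ := by
  refine ext_inner_indL2 fun C hC => ?_
  rw [X.inner_fwdSemigroup_indL2 t hA hC, ← X.adjoint_evalL2_apply 0 (MemLp.toLp _ _),
    ContinuousLinearMap.adjoint_inner_right, X.inner_evalL2_transition _ _ hA]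
  have hmA : MeasurableSet {ω : ℝ≥0 → Ω | ω t ∈ A} := measurableSet_eval t hA
  have hF : Measurable fun ω : ℝ≥0 → Ω => X.P (ω 0) {ω | ω t ∈ A} :=
    (X.P.measurable_coe hmA).comp (measurable_pi_apply 0)
  have := X.isMarkov
  congr 2
  refine lintegral_congr fun a => ?_
  have h1 : ∀ᵐ ω ∂(X.P a), X.P (ω 0) {ω | ω t ∈ A} = X.P a {ω | ω t ∈ A} :=
    X.ae_path (measurableSet_eq_fun hF measurable_const) fun ω _ h => by rw [h]
  rw [lintegral_congr_ae h1, lintegral_const, measure_univ, mul_one]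

theorem fwdSemigroup_add (s t : ℝ≥0) (f : Lp ℂ 2 μ) :
    X.fwdSemigroup (s + t) f = X.fwdSemigroup s (X.fwdSemigroup t f) := by
  -- The Markov property is available only for `s > 0`; after this case the claim is
  -- Chapman–Kolmogorov, tested on indicators.
  rcases eq_or_lt_of_le (show 0 ≤ s from zero_le) with rfl | hs
  · rw [zero_add, fwdSemigroup_zero]
  refine indL2_mem_induction (W := LinearMap.eqLocus (X.fwdSemigroup (s + t)).toLinearMap
    ((X.fwdSemigroup s).comp (X.fwdSemigroup t)).toLinearMap)
    (isClosed_eq (X.fwdSemigroup (s + t)).continuous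
      ((X.fwdSemigroup s).comp (X.fwdSemigroup t)).continuous) (fun A hA => ?_) f
  change X.fwdSemigroup (s + t) (indL2 μ hA) = X.fwdSemigroup s (X.fwdSemigroup t (indL2 μ hA))
  refine ext_inner_indL2 fun C hC => ?_
  rw [X.inner_fwdSemigroup_indL2 _ hA hC, X.fwdSemigroup_indL2 t hA, inner_fwdSemigroup,
    X.inner_evalL2_transition _ _ hA]
  congr 2
  refine lintegral_congr fun a => ?_
  rw [← X.markov s hs _ (measurableSet_eval t hA) a, add_comm s t]
  rfl

theorem isContractionSemigroup_adjSemigroup [BorelSpace Ω] :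
    IsContractionSemigroup X.adjSemigroup where
  map_zero f := X.adjoint_evalL2_apply 0 f
  map_add s t f := by
    refine ext_inner_left ℂ fun g => ?_
    simp only [← adjoint_fwdSemigroup, ContinuousLinearMap.adjoint_inner_right]
    rw [← fwdSemigroup_add, add_comm]
  norm_le t f := (X.norm_adjoint_evalL2_le t _).trans (X.norm_evalL2 0 f).le
  tendsto f := by
    refine tendsto_iff_norm_sub_tendsto_zero.2 ?_
    refine squeeze_zero (fun _ => norm_nonneg _) (fun t => ?_)
      (tendsto_iff_norm_sub_tendsto_zero.1 (X.tendsto_evalL2 f))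
    -- Writing `f` as the adjoint of evaluation at `t` applied to `f(ω_t)` puts the difference of
    -- two evaluations under a contraction.
    have h : X.adjSemigroup t f - f =
        ContinuousLinearMap.adjoint (X.evalL2 t) (X.evalL2 0 f - X.evalL2 t f) := by
      rw [map_sub, X.adjoint_evalL2_apply]
      rfl
    rw [h, norm_sub_rev (X.evalL2 t f)]
    exact X.norm_adjoint_evalL2_le t _

theorem adjSemigroup_const (t : ℝ≥0) (c : ℂ) :
    X.adjSemigroup t (Lp.const 2 μ c) = Lp.const 2 μ c := by
  change ContinuousLinearMap.adjoint (X.evalL2 t) (X.evalL2 0 (Lp.const 2 μ c)) = _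
  rw [evalL2_const, ← X.evalL2_const t, X.adjoint_evalL2_apply]

theorem inner_const_adjSemigroup (t : ℝ≥0) (c : ℂ) (f : Lp ℂ 2 μ) :
    ⟪Lp.const 2 μ c, X.adjSemigroup t f⟫_ℂ = ⟪Lp.const 2 μ c, f⟫_ℂ := by
  have h : X.adjSemigroup t f =
    ContinuousLinearMap.adjoint (X.evalL2 t) (X.evalL2 0 f) := rfl
  rw [h, ContinuousLinearMap.adjoint_inner_right, evalL2_const, ← X.evalL2_const 0]
  exact LinearIsometry.inner_map_map _ _ _

end Probability

end Environment

/-! ### Operators with a distinguished null vector -/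

section NullVector

variable {E : Type*} [NormedAddCommGroup E] [InnerProductSpace ℂ E]

theorem inner_smul_self_right_of_norm_eq_one {e : E} (he : ‖e‖ = 1) (c : ℂ) :
    ⟪e, c • e⟫_ℂ = c := by
  rw [inner_smul_right, inner_self_eq_norm_sq_to_K, he]
  simp

theorem inner_sub_inner_smul {e : E} (he : ‖e‖ = 1) (x : E) : ⟪e, x - ⟪e, x⟫_ℂ • e⟫_ℂ = 0 := by
  rw [inner_sub_right, inner_smul_self_right_of_norm_eq_one he, sub_self]

theorem norm_add_smul_sq {e x : E} (he : ‖e‖ = 1) (hx : ⟪e, x⟫_ℂ = 0) (c : ℂ) :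
    ‖x + c • e‖ ^ 2 = ‖x‖ ^ 2 + ‖c‖ ^ 2 := by
  have h : ⟪x, c • e⟫_ℂ = 0 := by
    rw [inner_smul_right, ← inner_conj_symm, hx, map_zero, mul_zero]
  rw [sq, norm_add_sq_eq_norm_sq_add_norm_sq_of_inner_eq_zero _ _ h, norm_smul, he]
  ring

theorem norm_sq_eq_of_norm_eq_one {e : E} (he : ‖e‖ = 1) (x : E) :
    ‖x‖ ^ 2 = ‖x - ⟪e, x⟫_ℂ • e‖ ^ 2 + ‖⟪e, x⟫_ℂ‖ ^ 2 := by
  rw [← norm_add_smul_sq he (inner_sub_inner_smul he x), sub_add_cancel]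

theorem norm_sub_inner_smul_le {e : E} (he : ‖e‖ = 1) (x : E) : ‖x - ⟪e, x⟫_ℂ • e‖ ≤ ‖x‖ := by
  refine le_of_sq_le_sq ?_ (norm_nonneg _)
  rw [norm_sq_eq_of_norm_eq_one he x]
  exact le_add_of_nonneg_right (sq_nonneg _)

/-- `e` is a unit vector in the kernel of `A` and orthogonal to the range of `A`. -/
structure IsNullVector (A : E →ₗ.[ℂ] E) (e : E) : Prop where
  norm_eq_one : ‖e‖ = 1
  mem_graph : (e, 0) ∈ A.graph
  inner_eq_zero : ∀ x z, (x, z) ∈ A.graph → ⟪e, z⟫_ℂ = 0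

variable {A : E →ₗ.[ℂ] E} {e : E}

theorem IsNullVector.sub_mem_graph (he : IsNullVector A e) {x z : E} (h : (x, z) ∈ A.graph)
    (c : ℂ) : (x - c • e, z) ∈ A.graph := by
  simpa using A.graph.sub_mem h (A.graph.smul_mem c he.mem_graph)

/-- Pairing `(A - w) R y = y` with `e` gives `-w ⟪e, R y⟫ = ⟪e, y⟫`, so `R` preserves the complement
of `e`. -/
theorem IsNullVector.exists_isResolvent_restrictTo (he : IsNullVector A e) {w : ℂ} (hw : w ≠ 0)
    {R : E →L[ℂ] E} (hR : IsResolvent A w R) :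
    ∃ R', IsResolvent (restrictTo A (ℂ ∙ e)ᗮ) w R' := by
  refine hR.restrictTo _ fun y hy => ?_
  rw [Submodule.mem_orthogonal_singleton_iff_inner_right] at hy ⊢
  have h := he.inner_eq_zero _ _ ((isResolvent_iff_graph.1 hR).1 y)
  rw [inner_add_right, hy, zero_add, inner_smul_right] at h
  exact (mul_eq_zero.1 h).resolve_left hw

/-- A resolvent on the orthogonal complement of a null vector extends to the whole space. -/
theorem IsNullVector.exists_isResolvent (he : IsNullVector A e) {w : ℂ} (hw : w ≠ 0)
    {R : (ℂ ∙ e)ᗮ →L[ℂ] (ℂ ∙ e)ᗮ} (hR : IsResolvent (restrictTo A (ℂ ∙ e)ᗮ) w R) :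
    ∃ R', IsResolvent A w R' ∧ ‖R'‖ ≤ ‖R‖ + 1 / ‖w‖ := by
  have he1 := he.norm_eq_one
  let Q : E →L[ℂ] (ℂ ∙ e)ᗮ :=
    (ContinuousLinearMap.id ℂ E - (innerSL ℂ e).smulRight e).codRestrict _ fun x => by
      rw [Submodule.mem_orthogonal_singleton_iff_inner_right]
      exact inner_sub_inner_smul he1 x
  have hQ : ∀ x, (Q x : E) = x - ⟪e, x⟫_ℂ • e := fun x => rfl
  -- On the line of `e`, where `A = 0`, the inverse of `A - w` is `-1/w`.
  let R' : E →L[ℂ] E := ((ℂ ∙ e)ᗮ.subtypeL.comp R).comp Q - w⁻¹ • (innerSL ℂ e).smulRight e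
  have hR' : ∀ y, R' y = (R (Q y) : E) - (w⁻¹ * ⟪e, y⟫_ℂ) • e := fun y => by
    rw [mul_smul]; rfl
  rw [isResolvent_iff_graph] at hR
  refine ⟨R', isResolvent_iff_graph.2 ⟨fun y => ?_, fun x z hxz => ?_⟩, ?_⟩
  · have h := he.sub_mem_graph ((mem_restrictTo_graph _ _ _ _).1 (hR.1 (Q y))) (w⁻¹ * ⟪e, y⟫_ℂ)
    rw [hR']
    convert h using 2
    rw [Submodule.coe_add, hQ, Submodule.coe_smul, smul_sub, smul_smul, mul_inv_cancel_left₀ hw]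
    abel
  · have hz := he.inner_eq_zero _ _ hxz
    have hmem : (Q x, Q z) ∈ (restrictTo A (ℂ ∙ e)ᗮ).graph := by
      rw [mem_restrictTo_graph, hQ, hQ, hz, zero_smul, sub_zero]
      exact he.sub_mem_graph hxz _
    have h := hR.2 _ _ hmem
    rw [hR', map_sub, map_smul, h, hQ, inner_sub_right, hz, inner_smul_right, zero_sub, mul_neg,
      inv_mul_cancel_left₀ hw, neg_smul]
    abel
  · refine R'.opNorm_le_bound (by positivity) fun y => ?_
    rw [hR', add_mul]
    refine (norm_sub_le _ _).trans (add_le_add ?_ ?_)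
    · refine (R.le_opNorm (Q y)).trans ?_
      gcongr
      exact norm_sub_inner_smul_le he1 y
    · rw [norm_smul, he1, mul_one, norm_mul, norm_inv, one_div]
      gcongr
      simpa [he1] using norm_inner_le_norm (𝕜 := ℂ) e y

end NullVector

/-! ### Operators with a gap and a sectorial numerical range -/

section Gapped

variable {E : Type*} [NormedAddCommGroup E] [InnerProductSpace ℂ E]

/-- An m-accretive operator with null vector `e`, and with spectral gap `1 / T` and sectorial
numerical range on the orthogonal complement of `e`. -/
structure IsGapped (B : E →ₗ.[ℂ] E) (e : E) (T q b : ℝ) : Prop extends IsNullVector B e where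
  gap : ∀ x z, (x, z) ∈ B.graph → ⟪e, x⟫_ℂ = 0 → 1 / T * ‖x‖ ^ 2 ≤ (⟪x, z⟫_ℂ).re
  sectorial : ∀ x z, (x, z) ∈ B.graph → ⟪e, x⟫_ℂ = 0 → ‖x‖ = 1 →
    |(⟪x, z⟫_ℂ).im| ≤ q * |(⟪x, z⟫_ℂ).re + b|
  exists_isResolvent_neg : ∀ a : ℝ, 0 < a → ∃ R, IsResolvent B (-a : ℂ) R

/-- Points far away from the origin and outside of a larger sector are at distance comparable to
their modulus from a sector. -/
theorem norm_sub_ge_of_sector {ν w : ℂ} {q b r : ℝ} (hq : 1 ≤ q) (hb : 0 ≤ b) (hr : 0 ≤ r)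
    (hν : 0 ≤ ν.re) (hν' : |ν.im| ≤ q * (ν.re + b))
    (hw : (w.re ≤ r ∧ 2 * (q * (r + b) + r) ≤ ‖w‖) ∨ (0 ≤ w.re ∧ 2 * q * (w.re + b) ≤ |w.im|)) :
    1 / (8 * (1 + q)) * ‖w‖ ≤ ‖ν - w‖ := by
  by_contra! hlt
  set δ := ‖ν - w‖ with hδ
  have hre : |ν.re - w.re| ≤ δ := by simpa using Complex.abs_re_le_norm (ν - w)
  have him : |ν.im - w.im| ≤ δ := by simpa using Complex.abs_im_le_norm (ν - w)
  have hW : ‖w‖ ≤ |w.re| + |w.im| := Complex.norm_le_abs_re_add_abs_im w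
  have h8 : 8 * (1 + q) * δ < ‖w‖ := by
    rw [one_div_mul_eq_div, lt_div_iff₀ (by positivity)] at hlt
    linarith
  have hδ0 : 0 ≤ δ := norm_nonneg _
  have hwim : |w.im| ≤ |ν.im| + δ := by
    have := abs_sub_abs_le_abs_sub w.im ν.im
    rw [abs_sub_comm] at this
    linarith
  have h1 := abs_le.1 hre
  have h2 : q * (ν.re + b) ≤ q * (w.re + δ + b) := by gcongr; linarith
  -- If `ν` were within `δ` of `w`, then `|Im w| ≤ q (Re w + δ + b) + δ`. In both cases the factor
  -- `2` in the hypothesis absorbs the terms without `δ`, leaving `‖w‖` below `8 (1 + q) δ`.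
  rcases hw with ⟨hw1, hw2⟩ | ⟨hw1, hw2⟩
  · have h3 : |w.re| ≤ r + δ := abs_le.2 ⟨by linarith, by linarith⟩
    have h4 : q * (w.re + δ + b) ≤ q * (r + δ + b) := by gcongr
    nlinarith
  · rw [abs_of_nonneg hw1] at hW
    nlinarith [mul_nonneg (sub_nonneg.2 hq) (add_nonneg hw1 hb)]

namespace IsGapped

variable {B : E →ₗ.[ℂ] E} {e : E} {T q b : ℝ}

/-- The range is orthogonal to `e`, so removing the `e` component of `x` changes neither `z` nor the
inner product. -/
theorem re_inner_ge (hB : IsGapped B e T q b) {x z : E} (h : (x, z) ∈ B.graph) :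
    1 / T * ‖x - ⟪e, x⟫_ℂ • e‖ ^ 2 ≤ (⟪x, z⟫_ℂ).re := by
  have h1 := hB.gap _ _ (hB.sub_mem_graph h _) (inner_sub_inner_smul hB.norm_eq_one x)
  rwa [inner_sub_left, inner_smul_left, hB.inner_eq_zero _ _ h, mul_zero, sub_zero] at h1

theorem re_inner_nonneg (hB : IsGapped B e T q b) (hT : 0 < T) {x z : E} (h : (x, z) ∈ B.graph) :
    0 ≤ (⟪x, z⟫_ℂ).re :=
  le_trans (by positivity) (hB.re_inner_ge h)

/-- On the orthogonal complement of the null vector, a gapped operator is onto. -/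
theorem exists_mem_graph [CompleteSpace E] (hB : IsGapped B e T q b) (hT : 0 < T) {g : E}
    (hg : ⟪e, g⟫_ℂ = 0) : ∃ u, (u, g) ∈ B.graph ∧ ⟪e, u⟫_ℂ = 0 := by
  obtain ⟨R, hR⟩ := hB.exists_isResolvent_neg 1 one_pos
  have hR' := hB.exists_isResolvent_restrictTo (by simp) hR
  have hmem : ∀ {x : E}, x ∈ (ℂ ∙ e)ᗮ ↔ ⟪e, x⟫_ℂ = 0 :=
    Submodule.mem_orthogonal_singleton_iff_inner_right
  -- Continuation from `-1` to `0` in the closed left half-plane, where the gap supplies the uniform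
  -- lower bound `1 / T`.
  have h := exists_isResolvent_of_convex (A := restrictTo B (ℂ ∙ e)ᗮ) (S := {w | w.re ≤ 0})
    (convex_halfSpace_re_le 0) (m := 1 / T) (by positivity) (fun w hw x z hxz => by
      rw [mem_restrictTo_graph] at hxz
      refine le_trans ?_ (norm_sub_smul_ge_of_re_inner (w := w)
        (hB.gap _ _ hxz (hmem.1 x.2)))
      rw [Submodule.coe_norm]
      gcongr
      exact le_sub_self_iff _ |>.2 hw) (w₁ := 0) (by simp) (by simp) hR'
  obtain ⟨R₀, hR₀⟩ := h
  have h1 := (mem_restrictTo_graph _ _ _ _).1 ((isResolvent_iff_graph.1 hR₀).1 ⟨g, hmem.2 hg⟩)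
  refine ⟨_, ?_, hmem.1 (R₀ ⟨g, hmem.2 hg⟩).2⟩
  simpa using h1

/-- Lower bound for `B - w` at large `w` outside of a sector. -/
theorem norm_sub_smul_ge (hB : IsGapped B e T q b) (hT : 0 < T) {w : ℂ} {r : ℝ} (hr : 0 ≤ r)
    (hw : (w.re ≤ r ∧ 2 * ((|q| + 1) * (r + |b|) + r) ≤ ‖w‖) ∨
      (0 ≤ w.re ∧ 2 * (|q| + 1) * (w.re + |b|) ≤ |w.im|)) {x z : E} (h : (x, z) ∈ B.graph) :
    1 / (8 * (1 + (|q| + 1))) * ‖w‖ * ‖x‖ ≤ ‖z - w • x‖ := by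
  set ε := 1 / (8 * (1 + (|q| + 1))) with hε
  have hε0 : 0 < ε := by positivity
  have hε1 : ε ≤ 1 := by
    rw [hε, div_le_one (by positivity)]
    have := abs_nonneg q
    linarith
  have key : ∀ y k, (y, k) ∈ B.graph → ⟪e, y⟫_ℂ = 0 → ε * ‖w‖ * ‖y‖ ≤ ‖k - w • y‖ := by
    intro y k hyk hy
    rcases eq_or_ne y 0 with rfl | hy0
    · simp
    have hn : 0 < ‖y‖ := norm_pos_iff.2 hy0
    set a : ℂ := ((‖y‖⁻¹ : ℝ) : ℂ) with ha
    have hna : ‖a‖ = ‖y‖⁻¹ := by rw [ha, Complex.norm_real, Real.norm_of_nonneg (by positivity)]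
    have hy1 : ‖a • y‖ = 1 := by rw [norm_smul, hna, inv_mul_cancel₀ hn.ne']
    have hmem : (a • y, a • k) ∈ B.graph := B.graph.smul_mem a hyk
    have hort : ⟪e, a • y⟫_ℂ = 0 := by rw [inner_smul_right, hy, mul_zero]
    have hre : 0 ≤ (⟪a • y, a • k⟫_ℂ).re := hB.re_inner_nonneg hT hmem
    have him : |(⟪a • y, a • k⟫_ℂ).im| ≤ (|q| + 1) * ((⟪a • y, a • k⟫_ℂ).re + |b|) := by
      refine (hB.sectorial _ _ hmem hort hy1).trans ?_
      have h1 : |(⟪a • y, a • k⟫_ℂ).re + b| ≤ (⟪a • y, a • k⟫_ℂ).re + |b| := by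
        refine (abs_add_le _ _).trans ?_
        rw [abs_of_nonneg hre]
      refine mul_le_mul ?_ h1 (abs_nonneg _) (by positivity)
      linarith [le_abs_self q]
    have h2 := norm_sub_ge_of_sector (by linarith [abs_nonneg q]) (abs_nonneg b) hr hre him hw
    have h3 : ⟪a • y, a • k⟫_ℂ - w = ⟪a • y, a • (k - w • y)⟫_ℂ := by
      rw [smul_sub, inner_sub_right, smul_comm a w, inner_smul_self_right_of_norm_eq_one hy1]
    rw [h3] at h2
    have h4 := h2.trans (norm_inner_le_norm _ _)
    rw [hy1, one_mul, norm_smul, hna, inv_mul_eq_div, le_div_iff₀ hn] at h4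
    exact h4
  have he := hB.norm_eq_one
  set c := ⟪e, x⟫_ℂ with hc
  have h1 := key _ _ (hB.sub_mem_graph h c) (inner_sub_inner_smul he x)
  -- An orthogonal splitting: `key` bounds the first term, and the second has norm `|w| |c|`, which
  -- is enough because `ε ≤ 1`.
  have h2 : z - w • x = (z - w • (x - c • e)) + (-(w * c)) • e := by
    rw [smul_sub, smul_smul, neg_smul]; abel
  have h3 : ⟪e, z - w • (x - c • e)⟫_ℂ = 0 := by
    rw [inner_sub_right, inner_smul_right, inner_sub_inner_smul he, hB.inner_eq_zero _ _ h,
      mul_zero, sub_zero]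
  refine le_of_sq_le_sq ?_ (norm_nonneg _)
  rw [h2, norm_add_smul_sq he h3, mul_pow, norm_sq_eq_of_norm_eq_one he x, mul_add, norm_neg,
    norm_mul, ← mul_pow, mul_pow]
  refine add_le_add ?_ ?_
  · rw [← mul_pow]; gcongr
  · rw [← hc, mul_pow, mul_pow]
    gcongr
    exact mul_le_of_le_one_left (sq_nonneg _) (pow_le_one₀ hε0.le hε1)

end IsGapped

end Gapped

/-! ### Perturbation of a direct sum of gapped operators -/

section HilbertSum

variable {ι : Type*} {E : Type*} [NormedAddCommGroup E]

theorem summable_norm_sq (x : lp (fun _ : ι => E) 2) : Summable fun i => ‖x i‖ ^ 2 := by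
  have h := (memℓp_gen_iff (p := 2) (by simp)).1 (lp.memℓp x)
  simpa only [ENNReal.toReal_ofNat, Real.rpow_ofNat] using h

theorem norm_sq_eq_tsum (x : lp (fun _ : ι => E) 2) : ‖x‖ ^ 2 = ∑' i, ‖x i‖ ^ 2 := by
  have h := lp.norm_rpow_eq_tsum (p := 2) (by simp) x
  simpa only [ENNReal.toReal_ofNat, Real.rpow_ofNat] using h

theorem mul_norm_le_of_forall {m : ℝ} (hm : 0 ≤ m) {x y : lp (fun _ : ι => E) 2}
    (h : ∀ i, m * ‖x i‖ ≤ ‖y i‖) : m * ‖x‖ ≤ ‖y‖ := by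
  refine le_of_sq_le_sq ?_ (norm_nonneg _)
  rw [mul_pow, norm_sq_eq_tsum, norm_sq_eq_tsum, ← tsum_mul_left]
  refine ((summable_norm_sq x).mul_left _).tsum_le_tsum (fun i => ?_) (summable_norm_sq y)
  rw [← mul_pow]
  have := h i
  gcongr

variable [InnerProductSpace ℂ E]

theorem mem_orthogonal_single_iff [DecidableEq ι] {e : E} {o : ι} {x : lp (fun _ : ι => E) 2} :
    x ∈ (ℂ ∙ (lp.single 2 o e : lp (fun _ : ι => E) 2))ᗮ ↔ ⟪e, x o⟫_ℂ = 0 := by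
  rw [Submodule.mem_orthogonal_singleton_iff_inner_right, lp.inner_single_left]

/-- The component of `x` in `ℓ²(ι) ⊗ e`. -/
def alongPart (e : E) : lp (fun _ : ι => E) 2 →L[ℂ] lp (fun _ : ι => E) 2 :=
  blockOp (Equiv.refl ι) (fun _ => (innerSL ℂ e).smulRight e) _ fun _ => le_rfl

theorem alongPart_apply (e : E) (x : lp (fun _ : ι => E) 2) (i : ι) :
    alongPart e x i = ⟪e, x i⟫_ℂ • e := rfl

theorem norm_alongPart_sq {e : E} (he : ‖e‖ = 1) (x : lp (fun _ : ι => E) 2) :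
    ‖x‖ ^ 2 = ‖x - alongPart e x‖ ^ 2 + ‖alongPart e x‖ ^ 2 := by
  rw [norm_sq_eq_tsum, norm_sq_eq_tsum, norm_sq_eq_tsum,
    ← (summable_norm_sq _).tsum_add (summable_norm_sq _)]
  refine tsum_congr fun i => ?_
  rw [norm_sq_eq_of_norm_eq_one he (x i), alongPart_apply, norm_smul, he, mul_one]
  rfl

/-- A bounded symmetric operator on `ℓ²(ι; E)` that maps `c_i ⊗ e` to `c_i g_i`, where the `g_i`
are orthogonal to `e`, `g_o = 0` and `B⁻¹ g_i` is bounded below for `i ≠ o`. -/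
structure IsCoupling (A : lp (fun _ : ι => E) 2 →L[ℂ] lp (fun _ : ι => E) 2) (B : E →ₗ.[ℂ] E)
    (e : E) (o : ι) (g : ι → E) (χ : ℝ) : Prop where
  symm : ∀ x y, ⟪x, A y⟫_ℂ = ⟪A x, y⟫_ℂ
  apply_alongPart : ∀ x i, A (alongPart e x) i = ⟪e, x i⟫_ℂ • g i
  apply_origin : g o = 0
  inner_eq_zero : ∀ i, ⟪e, g i⟫_ℂ = 0
  nondegenerate : ∀ i, i ≠ o → ∀ u, (u, g i) ∈ B.graph → ⟪e, u⟫_ℂ = 0 → χ ≤ ‖u‖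

variable {A : lp (fun _ : ι => E) 2 →L[ℂ] lp (fun _ : ι => E) 2} {B : E →ₗ.[ℂ] E} {e : E}
  {o : ι} {g : ι → E} {χ T q b : ℝ}

/-- The operator `i A + 1 ⊗ B`. -/
def coupledOp (A : lp (fun _ : ι => E) 2 →L[ℂ] lp (fun _ : ι => E) 2) (B : E →ₗ.[ℂ] E) :
    lp (fun _ : ι => E) 2 →ₗ.[ℂ] lp (fun _ : ι => E) 2 :=
  (Complex.I • A).toLinearMap +ᵥ ampliation ι B

theorem mem_coupledOp_graph {x z : lp (fun _ : ι => E) 2} :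
    (x, z) ∈ (coupledOp A B).graph ↔ ∀ i, (x i, (z - Complex.I • A x) i) ∈ B.graph := by
  rw [coupledOp, mem_vadd_graph, mem_ampliation_graph]
  rfl

/-! ### Lower bounds and spectrum of the coupled operator -/

namespace IsCoupling

theorem alongPart_single [DecidableEq ι] (he : ‖e‖ = 1) (o : ι) :
    alongPart e (lp.single 2 o e : lp (fun _ : ι => E) 2) = lp.single 2 o e := by
  ext i : 2
  rw [alongPart_apply]
  by_cases h : i = o
  · subst h
    rw [lp.single_apply_self, inner_self_eq_norm_sq_to_K, he]
    simp
  · rw [lp.single_apply_ne _ _ _ h, inner_zero_right, zero_smul]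

theorem apply_single [DecidableEq ι] (hA : IsCoupling A B e o g χ) (he : ‖e‖ = 1) :
    A (lp.single 2 o e) = 0 := by
  ext i : 2
  rw [← alongPart_single he, hA.apply_alongPart]
  by_cases h : i = o
  · subst h
    rw [hA.apply_origin, smul_zero]; rfl
  · rw [lp.single_apply_ne _ _ _ h, inner_zero_right, zero_smul]; rfl

theorem isNullVector [DecidableEq ι] (hA : IsCoupling A B e o g χ) (hB : IsNullVector B e) :
    IsNullVector (coupledOp A B) (lp.single 2 o e) where
  norm_eq_one := by
    rw [lp.norm_single (by simp), hB.norm_eq_one]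
  mem_graph := by
    rw [mem_coupledOp_graph]
    intro i
    rw [hA.apply_single hB.norm_eq_one, smul_zero, sub_zero]
    by_cases h : i = o
    · subst h
      rw [lp.single_apply_self]
      exact hB.mem_graph
    · rw [lp.single_apply_ne _ _ _ h]
      exact B.graph.zero_mem
  inner_eq_zero x z hxz := by
    rw [mem_coupledOp_graph] at hxz
    have h1 : ⟪(lp.single 2 o e : lp (fun _ : ι => E) 2), Complex.I • A x⟫_ℂ = 0 := by
      rw [inner_smul_right, hA.symm, hA.apply_single hB.norm_eq_one, inner_zero_left, mul_zero]
    have h2 := hB.inner_eq_zero _ _ (hxz o)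
    have h3 := lp.inner_single_left (𝕜 := ℂ) o e (z - Complex.I • A x)
    rwa [h2, inner_sub_right, h1, sub_zero] at h3

/-- Symmetry of `A` makes `⟪x, iA x⟫` purely imaginary; what remains is the gap of `B` summed over
the sites. -/
theorem re_inner_ge (hA : IsCoupling A B e o g χ) (hB : IsGapped B e T q b)
    {x z : lp (fun _ : ι => E) 2} (h : (x, z) ∈ (coupledOp A B).graph) :
    1 / T * ‖x - alongPart e x‖ ^ 2 ≤ (⟪x, z⟫_ℂ).re := by
  rw [mem_coupledOp_graph] at h
  have h1 : (⟪x, Complex.I • A x⟫_ℂ).re = 0 := by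
    rw [inner_smul_right, Complex.I_mul_re, neg_eq_zero, ← Complex.conj_eq_iff_im]
    rw [inner_conj_symm, hA.symm]
  have h2 : (⟪x, z⟫_ℂ).re = (⟪x, z - Complex.I • A x⟫_ℂ).re := by
    rw [inner_sub_right, Complex.sub_re, h1, sub_zero]
  have h3 := Complex.hasSum_re (lp.hasSum_inner (𝕜 := ℂ) x (z - Complex.I • A x))
  rw [h2, ← h3.tsum_eq, norm_sq_eq_tsum, ← tsum_mul_left]
  exact ((summable_norm_sq _).mul_left _).tsum_le_tsum (fun i => hB.re_inner_ge (h i)) h3.summable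

theorem re_inner_nonneg (hA : IsCoupling A B e o g χ) (hB : IsGapped B e T q b) (hT : 0 < T)
    {x z : lp (fun _ : ι => E) 2} (h : (x, z) ∈ (coupledOp A B).graph) : 0 ≤ (⟪x, z⟫_ℂ).re :=
  le_trans (by positivity) (hA.re_inner_ge hB h)

/-- The coupled operator is m-accretive. -/
theorem exists_isResolvent_neg [CompleteSpace E] (hB : IsGapped B e T q b)
    (hT : 0 < T) {a : ℝ} (ha : ‖A‖ < a) : ∃ R, IsResolvent (coupledOp A B) (-a : ℂ) R := by
  have ha0 : 0 < a := (norm_nonneg A).trans_lt ha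
  obtain ⟨R, hR⟩ := hB.exists_isResolvent_neg a ha0
  have hR' := hR.ampliation ι
  have hn := hR'.norm_le ha0 (fun x z hxz => mul_norm_le_of_forall ha0.le fun i => by
    rw [mem_ampliation_graph] at hxz
    have := norm_sub_smul_ge_of_re_inner (a := 0) (w := (-a : ℂ)) (by
      rw [zero_mul]
      exact hB.re_inner_nonneg hT (hxz i))
    rw [Complex.neg_re, Complex.ofReal_re, zero_sub, neg_neg] at this
    exact this)
  refine hR'.perturb (Complex.I • A) ?_
  rw [norm_smul, Complex.norm_I, one_mul]
  calc ‖A‖ * _ ≤ ‖A‖ * (1 / a) := by gcongr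
    _ < 1 := by rw [mul_one_div, div_lt_one ha0]; exact ha

/-- Lower bound for the coupled operator at large `w` outside of a sector. -/
theorem norm_sub_smul_ge_of_large (hB : IsGapped B e T q b) (hT : 0 < T) {w : ℂ} {r : ℝ}
    (hr : 0 ≤ r) (hw : (w.re ≤ r ∧ 2 * ((|q| + 1) * (r + |b|) + r) ≤ ‖w‖) ∨
      (0 ≤ w.re ∧ 2 * (|q| + 1) * (w.re + |b|) ≤ |w.im|)) {x z : lp (fun _ : ι => E) 2}
    (h : (x, z) ∈ (coupledOp A B).graph) :
    (1 / (8 * (1 + (|q| + 1))) * ‖w‖ - ‖A‖) * ‖x‖ ≤ ‖z - w • x‖ := by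
  rw [mem_coupledOp_graph] at h
  have h1 : 1 / (8 * (1 + (|q| + 1))) * ‖w‖ * ‖x‖ ≤ ‖z - Complex.I • A x - w • x‖ :=
    mul_norm_le_of_forall (by positivity) fun i => hB.norm_sub_smul_ge hT hr hw (h i)
  have h2 : ‖z - Complex.I • A x - w • x‖ ≤ ‖z - w • x‖ + ‖A‖ * ‖x‖ := by
    rw [show z - Complex.I • A x - w • x = (z - w • x) - Complex.I • A x by abel]
    refine (norm_sub_le _ _).trans (add_le_add le_rfl ?_)
    rw [norm_smul, Complex.norm_I, one_mul]
    exact A.le_opNorm x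
  rw [sub_mul]
  linarith

/-- The component along `e` is controlled by the other one, by the non-degeneracy of the
coupling. -/
theorem norm_alongPart_le [CompleteSpace E] (hA : IsCoupling A B e o g χ)
    (hB : IsGapped B e T q b) (hT : 0 < T) (hχ : 0 < χ) {w : ℂ} {x z : lp (fun _ : ι => E) 2}
    (h : (x, z) ∈ (coupledOp A B).graph) (hx : ⟪e, x o⟫_ℂ = 0) :
    χ ^ 2 * ‖alongPart e x‖ ^ 2 ≤ 3 * (((1 + T * ‖w‖) ^ 2 + T ^ 2 * ‖A‖ ^ 2) *
      ‖x - alongPart e x‖ ^ 2 + T ^ 2 * ‖z - w • x‖ ^ 2) := by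
  have he := hB.norm_eq_one
  set η := x - alongPart e x with hη
  set f := z - w • x with hf
  have hηi : ∀ i, η i = x i - ⟪e, x i⟫_ℂ • e := fun i => rfl
  have hsite : ∀ i, χ * ‖alongPart e x i‖ ≤
      (1 + T * ‖w‖) * ‖η i‖ + T * ‖A η i‖ + T * ‖f i‖ := by
    intro i
    rw [alongPart_apply, norm_smul, he, mul_one]
    by_cases hi : i = o
    · subst hi
      rw [hx, norm_zero, mul_zero]
      positivity
    -- `u = B⁻¹ g_i`. Adding `i c u` to `η i` moves the source term `i c g_i` under `B`, where the
    -- gap can be used.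
    obtain ⟨u, hu, hu0⟩ := hB.exists_mem_graph hT (hA.inner_eq_zero i)
    have hχu := hA.nondegenerate i hi u hu hu0
    rw [mem_coupledOp_graph] at h
    set c := ⟪e, x i⟫_ℂ with hc
    set k := (z - Complex.I • A x) i with hk
    have hmem : (η i + (Complex.I * c) • u, k + (Complex.I * c) • g i) ∈ B.graph :=
      B.graph.add_mem (hB.sub_mem_graph (h i) c) (B.graph.smul_mem _ hu)
    have hη0 : ⟪e, η i⟫_ℂ = 0 := inner_sub_inner_smul he (x i)
    have h0 : ⟪e, η i + (Complex.I * c) • u⟫_ℂ = 0 := by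
      rw [inner_add_right, inner_smul_right, hη0, hu0, mul_zero, add_zero]
    have hgap := norm_sub_smul_ge_of_re_inner (w := 0) (hB.gap _ _ hmem h0)
    rw [Complex.zero_re, sub_zero, zero_smul, sub_zero, one_div_mul_eq_div, div_le_iff₀ hT] at hgap
    have hk1 : k + (Complex.I * c) • g i = w • η i + (f i - Complex.I • A η i) + (w * c) • e := by
      have hAx : A x i = A η i + c • g i := by
        rw [← hA.apply_alongPart x i]
        change A x i = (A η + A (alongPart e x)) i
        rw [← map_add, hη, sub_add_cancel]
      change z i - Complex.I • A x i + _ =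
        w • (x i - c • e) + (z i - w • x i - Complex.I • A η i) + _
      rw [hAx, smul_add, smul_sub, smul_smul, smul_smul]
      abel
    -- The left side lies in the range of `B`, so its `e` component is zero. This eliminates `w c
    -- e`, the one term still proportional to `c`.
    have hk2 : k + (Complex.I * c) • g i = w • η i +
        ((f i - Complex.I • A η i) - ⟪e, f i - Complex.I • A η i⟫_ℂ • e) := by
      have h1 : ⟪e, k + (Complex.I * c) • g i⟫_ℂ = 0 := hB.inner_eq_zero _ _ hmem
      rw [hk1, inner_add_right, inner_add_right, inner_smul_right, hη0, mul_zero, zero_add,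
        inner_smul_self_right_of_norm_eq_one he] at h1
      rw [hk1, eq_neg_of_add_eq_zero_left h1, neg_smul]
      abel
    have hk3 : ‖k + (Complex.I * c) • g i‖ ≤ ‖w‖ * ‖η i‖ + (‖f i‖ + ‖A η i‖) := by
      rw [hk2]
      refine (norm_add_le _ _).trans (add_le_add (norm_smul _ _).le ?_)
      refine (norm_sub_inner_smul_le he _).trans ((norm_sub_le _ _).trans (le_of_eq ?_))
      rw [norm_smul, Complex.norm_I, one_mul]
    have h5 : ‖c‖ * ‖u‖ ≤ ‖η i + (Complex.I * c) • u‖ + ‖η i‖ := by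
      have h6 : ‖(Complex.I * c) • u‖ = ‖c‖ * ‖u‖ := by
        rw [norm_smul, norm_mul, Complex.norm_I, one_mul]
      rw [← h6]
      calc ‖(Complex.I * c) • u‖ = ‖(η i + (Complex.I * c) • u) - η i‖ := by
            rw [add_sub_cancel_left]
        _ ≤ _ := norm_sub_le _ _
    have h7 : χ * ‖c‖ ≤ ‖c‖ * ‖u‖ := by
      rw [mul_comm]; gcongr
    have h8 : ‖k + (Complex.I * c) • g i‖ * T ≤ (‖w‖ * ‖η i‖ + (‖f i‖ + ‖A η i‖)) * T := by
      gcongr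
    linarith
  have hsq : ∀ i, χ ^ 2 * ‖alongPart e x i‖ ^ 2 ≤ 3 * ((1 + T * ‖w‖) ^ 2) * ‖η i‖ ^ 2 +
      3 * T ^ 2 * ‖A η i‖ ^ 2 + 3 * T ^ 2 * ‖f i‖ ^ 2 := by
    intro i
    have h1 := pow_le_pow_left₀ (by positivity) (hsite i) 2
    set r := (1 + T * ‖w‖) * ‖η i‖ with hr
    set s := T * ‖A η i‖ with hs
    set t := T * ‖f i‖ with ht
    have h2 : (r + s + t) ^ 2 ≤ 3 * r ^ 2 + 3 * s ^ 2 + 3 * t ^ 2 := by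
      nlinarith [sq_nonneg (r - s), sq_nonneg (r - t), sq_nonneg (s - t)]
    rw [mul_pow] at h1
    refine (h1.trans h2).trans (le_of_eq ?_)
    rw [hr, hs, ht]
    ring
  have hsum : χ ^ 2 * ‖alongPart e x‖ ^ 2 ≤ 3 * ((1 + T * ‖w‖) ^ 2) * ‖η‖ ^ 2 +
      3 * T ^ 2 * ‖A η‖ ^ 2 + 3 * T ^ 2 * ‖f‖ ^ 2 := by
    rw [norm_sq_eq_tsum (alongPart e x), norm_sq_eq_tsum η, norm_sq_eq_tsum (A η),
      norm_sq_eq_tsum f, ← tsum_mul_left, ← tsum_mul_left, ← tsum_mul_left, ← tsum_mul_left]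
    have s1 := (summable_norm_sq η).mul_left (3 * ((1 + T * ‖w‖) ^ 2))
    have s2 := (summable_norm_sq (A η)).mul_left (3 * T ^ 2)
    have s3 := (summable_norm_sq f).mul_left (3 * T ^ 2)
    rw [← s1.tsum_add s2, ← (s1.add s2).tsum_add s3]
    exact ((summable_norm_sq _).mul_left _).tsum_le_tsum hsq ((s1.add s2).add s3)
  have hAη : ‖A η‖ ^ 2 ≤ ‖A‖ ^ 2 * ‖η‖ ^ 2 := by
    rw [← mul_pow]
    exact pow_le_pow_left₀ (norm_nonneg _) (A.le_opNorm η) 2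
  have := mul_le_mul_of_nonneg_left hAη (show 0 ≤ 3 * T ^ 2 by positivity)
  linarith

/-- Lower bound for the coupled operator in bounded regions left of the gap. -/
theorem exists_norm_sub_smul_ge_of_bounded [CompleteSpace E] (hA : IsCoupling A B e o g χ)
    (hB : IsGapped B e T q b) (hT : 0 < T) (hχ : 0 < χ) (ρ : ℝ) (hρ : 0 ≤ ρ) :
    ∃ γ m : ℝ, 0 < γ ∧ γ < 1 ∧ 0 < m ∧ ∀ w : ℂ, w.re ≤ γ / T → ‖w‖ ≤ ρ →
      ∀ x z, (x, z) ∈ (coupledOp A B).graph → ⟪e, x o⟫_ℂ = 0 → m * ‖x‖ ≤ ‖z - w • x‖ := by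
  set M : ℝ := 1 + 3 * ((1 + T * ρ) ^ 2 + T ^ 2 * ‖A‖ ^ 2) / χ ^ 2 with hM
  set N : ℝ := 3 * T ^ 2 / χ ^ 2 with hN
  have hM1 : 1 ≤ M := by
    rw [hM]
    exact le_add_of_nonneg_right (by positivity)
  have hN0 : 0 ≤ N := by positivity
  set D : ℝ := 2 * (M * T + N + 1) with hD
  have hD0 : 0 < D := by positivity
  -- `M` and `N` are chosen so that `‖x‖² ≤ M ‖η‖² + N ‖f‖²`. Then `γ = 1 / (2M)` makes the
  -- contribution of `Re w` at most `‖x‖² / 2`, which is absorbed; `D` satisfies `4 ((M T)² + N) ≤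
  -- D²`.
  refine ⟨1 / (2 * M), 1 / D, by positivity, ?_, by positivity, ?_⟩
  · rw [div_lt_one (by positivity)]
    linarith
  intro w hw hwρ x z hxz hx
  have h1 := hA.norm_alongPart_le hB hT hχ (w := w) hxz hx
  have h2 := norm_alongPart_sq hB.norm_eq_one x
  have h3 := hA.re_inner_ge hB hxz
  set η := x - alongPart e x with hη
  set f := z - w • x with hf
  have h4 : ‖alongPart e x‖ ^ 2 ≤ (M - 1) * ‖η‖ ^ 2 + N * ‖f‖ ^ 2 := by
    have h5 : χ ^ 2 * ‖alongPart e x‖ ^ 2 ≤ 3 * (((1 + T * ρ) ^ 2 + T ^ 2 * ‖A‖ ^ 2) *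
      ‖η‖ ^ 2 + T ^ 2 * ‖f‖ ^ 2) := by
      refine h1.trans ?_
      gcongr
    rw [mul_comm, ← le_div_iff₀ (by positivity)] at h5
    refine h5.trans (le_of_eq ?_)
    rw [hM, hN]
    ring
  have h5 : ‖η‖ ^ 2 ≤ T * (‖x‖ * ‖f‖) + 1 / (2 * M) * ‖x‖ ^ 2 := by
    have hz : z = f + w • x := by rw [hf, sub_add_cancel]
    have h6 : (⟪x, z⟫_ℂ).re ≤ ‖x‖ * ‖f‖ + w.re * ‖x‖ ^ 2 := by
      rw [hz, inner_add_right, Complex.add_re, inner_smul_right]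
      refine add_le_add ((Complex.re_le_norm _).trans (norm_inner_le_norm _ _)) (le_of_eq ?_)
      rw [inner_self_eq_norm_sq_to_K]
      change (w * ((‖x‖ : ℝ) : ℂ) ^ 2).re = _
      rw [← Complex.ofReal_pow, Complex.re_mul_ofReal]
    have h7 : w.re * ‖x‖ ^ 2 ≤ 1 / (2 * M) / T * ‖x‖ ^ 2 := by gcongr
    have h8 : 1 / T * ‖η‖ ^ 2 ≤ ‖x‖ * ‖f‖ + 1 / (2 * M) / T * ‖x‖ ^ 2 := by linarith
    have h9 := mul_le_mul_of_nonneg_left h8 hT.le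
    have e1 : T * (1 / T * ‖η‖ ^ 2) = ‖η‖ ^ 2 := by field_simp
    have e2 : T * (‖x‖ * ‖f‖ + 1 / (2 * M) / T * ‖x‖ ^ 2) =
        T * (‖x‖ * ‖f‖) + 1 / (2 * M) * ‖x‖ ^ 2 := by field_simp
    rwa [e1, e2] at h9
  have h6 : ‖x‖ ^ 2 ≤ M * (T * (‖x‖ * ‖f‖)) + 1 / 2 * ‖x‖ ^ 2 + N * ‖f‖ ^ 2 := by
    have h7 := mul_le_mul_of_nonneg_left h5 (show 0 ≤ M by linarith)
    have e1 : M * (T * (‖x‖ * ‖f‖) + 1 / (2 * M) * ‖x‖ ^ 2) =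
        M * (T * (‖x‖ * ‖f‖)) + 1 / 2 * ‖x‖ ^ 2 := by field_simp
    linarith
  have h7 : ‖x‖ ≤ D * ‖f‖ := by
    refine le_of_sq_le_sq ?_ (by positivity)
    have h8 : M * (T * (‖x‖ * ‖f‖)) ≤ 1 / 4 * ‖x‖ ^ 2 + (M * T) ^ 2 * ‖f‖ ^ 2 := by
      nlinarith [sq_nonneg (1 / 2 * ‖x‖ - M * T * ‖f‖)]
    have h9 : ‖x‖ ^ 2 ≤ 4 * ((M * T) ^ 2 + N) * ‖f‖ ^ 2 := by linarith
    refine h9.trans ?_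
    rw [mul_pow D]
    refine mul_le_mul_of_nonneg_right ?_ (sq_nonneg _)
    have : 0 ≤ M * T := by positivity
    rw [hD]
    nlinarith [mul_nonneg this hN0]
  rw [one_div_mul_eq_div, div_le_iff₀ hD0, mul_comm]
  exact h7

/-- Lower bound for the coupled operator outside of a truncated sector. -/
theorem exists_norm_sub_smul_ge [CompleteSpace E] (hA : IsCoupling A B e o g χ)
    (hB : IsGapped B e T q b) (hT : 0 < T) (hχ : 0 < χ) :
    ∃ γ p c m : ℝ, 0 < γ ∧ γ < 1 ∧ 0 < p ∧ 0 < c ∧ 0 < m ∧ ∀ w ∉ truncatedSector T γ p c,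
      ∀ x z, (x, z) ∈ (coupledOp A B).graph → ⟪e, x o⟫_ℂ = 0 →
        m * (1 + ‖w‖) * ‖x‖ ≤ ‖z - w • x‖ := by
  set ε : ℝ := 1 / (8 * (1 + (|q| + 1))) with hε
  have hε0 : 0 < ε := by positivity
  -- The middle term is the large-`w` threshold with `r = 1 / T`; the last one ensures `‖A‖ ≤ ε ‖w‖
  -- / 2` when `‖w‖ > ρ`.
  set ρ : ℝ := 1 + 2 * ((|q| + 1) * (1 / T + |b|) + 1 / T) + 2 * ‖A‖ / ε with hρ
  have hρ1 : 1 ≤ ρ := by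
    rw [hρ, add_assoc]
    exact le_add_of_nonneg_right (by positivity)
  obtain ⟨γ, m, hγ0, hγ1, hm0, hm⟩ :=
    hA.exists_norm_sub_smul_ge_of_bounded hB hT hχ ρ (by linarith)
  -- The shift `|b| + ρ` puts the part of the disc `‖w‖ ≤ ρ` to the right of `γ / T` inside the
  -- sector, so only its left part needs the bounded estimate.
  refine ⟨γ, 2 * (|q| + 1), |b| + ρ, min (m / (1 + ρ)) (ε / 4), hγ0, hγ1, by positivity,
    by positivity, by positivity, fun w hw x z hxz hx => ?_⟩
  rcases le_or_gt ‖w‖ ρ with hwρ | hwρ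
  · have hre : w.re ≤ γ / T := by
      by_contra! hre
      refine hw ⟨hre.le, ?_⟩
      have h0 : 0 ≤ w.re := le_trans (by positivity) hre.le
      have h1 := Complex.abs_im_le_norm w
      nlinarith [abs_nonneg q, abs_nonneg b]
    refine le_trans ?_ (hm w hre hwρ x z hxz hx)
    gcongr
    calc min (m / (1 + ρ)) (ε / 4) * (1 + ‖w‖) ≤ m / (1 + ρ) * (1 + ρ) := by
          gcongr
          exact min_le_left _ _
      _ = m := div_mul_cancel₀ _ (by positivity)
  · have hw' : (w.re ≤ 1 / T ∧ 2 * ((|q| + 1) * (1 / T + |b|) + 1 / T) ≤ ‖w‖) ∨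
        (0 ≤ w.re ∧ 2 * (|q| + 1) * (w.re + |b|) ≤ |w.im|) := by
      rcases le_or_gt w.re (γ / T) with hre | hre
      · refine Or.inl ⟨hre.trans (by gcongr), le_trans ?_ hwρ.le⟩
        rw [hρ]
        have : 0 ≤ 2 * ‖A‖ / ε := by positivity
        linarith
      · refine Or.inr ⟨le_trans (by positivity) hre.le, ?_⟩
        have h1 : ¬ |w.im| ≤ 2 * (|q| + 1) * (w.re + (|b| + ρ)) := fun h => hw ⟨hre.le, h⟩
        refine le_trans ?_ (not_le.1 h1).le
        gcongr
        linarith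
    refine le_trans ?_ (norm_sub_smul_ge_of_large hB hT (by positivity) hw' hxz)
    gcongr
    have h1 : ‖A‖ ≤ ε / 2 * ‖w‖ := by
      have h2 : 2 * ‖A‖ / ε ≤ ‖w‖ := by
        refine le_trans ?_ hwρ.le
        rw [hρ]
        have : 0 ≤ 2 * ((|q| + 1) * (1 / T + |b|) + 1 / T) := by positivity
        linarith
      rw [div_le_iff₀ hε0] at h2
      linarith
    calc min (m / (1 + ρ)) (ε / 4) * (1 + ‖w‖) ≤ ε / 4 * (‖w‖ + ‖w‖) := by
          gcongr
          · exact min_le_right _ _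
          · linarith
      _ ≤ ε * ‖w‖ - ‖A‖ := by linarith

/-- Spectrum of the coupled operator on the complement of its null vector, and resolvent bound. -/
theorem exists_truncatedSector [DecidableEq ι] [CompleteSpace E] (hA : IsCoupling A B e o g χ)
    (hB : IsGapped B e T q b) (hT : 0 < T) (hχ : 0 < χ) :
    ∃ γ p c : ℝ, 0 < γ ∧ γ < 1 ∧ 0 < p ∧ 0 < c ∧
      pspectrum (restrictTo (coupledOp A B) (ℂ ∙ (lp.single 2 o e : lp (fun _ : ι => E) 2))ᗮ) ⊆
        truncatedSector T γ p c ∧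
      ∃ C : ℝ, ∀ w : ℂ, w ∉ {0} ∪ truncatedSector T γ p c →
        ∃ R, IsResolvent (coupledOp A B) w R ∧
          ‖R‖ ≤ C / Metric.infDist w ({0} ∪ truncatedSector T γ p c) := by
  obtain ⟨γ, p, c, m, hγ0, hγ1, hp, hc, hm, hlow⟩ := hA.exists_norm_sub_smul_ge hB hT hχ
  set δ : lp (fun _ : ι => E) 2 := lp.single 2 o e with hδ
  have hnull := hA.isNullVector hB.toIsNullVector
  have hlow' : ∀ w ∉ truncatedSector T γ p c, ∀ x z,
      (x, z) ∈ (restrictTo (coupledOp A B) (ℂ ∙ δ)ᗮ).graph →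
        m * (1 + ‖w‖) * ‖x‖ ≤ ‖z - w • x‖ := by
    intro w hw x z hxz
    exact hlow w hw x z ((mem_restrictTo_graph _ _ _ _).1 hxz) (mem_orthogonal_single_iff.1 x.2)
  have hlow1 : ∀ w ∉ truncatedSector T γ p c, ∀ x z,
      (x, z) ∈ (restrictTo (coupledOp A B) (ℂ ∙ δ)ᗮ).graph → m * ‖x‖ ≤ ‖z - w • x‖ := by
    intro w hw x z hxz
    refine le_trans ?_ (hlow' w hw x z hxz)
    gcongr
    exact le_mul_of_one_le_right hm.le (le_add_of_nonneg_right (norm_nonneg _))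
  have hres : ∀ w ∉ truncatedSector T γ p c,
      ∃ R, IsResolvent (restrictTo (coupledOp A B) (ℂ ∙ δ)ᗮ) w R := by
    intro w hw
    set a : ℝ := ‖A‖ + 1 with ha
    have ha0 : 0 < a := by positivity
    obtain ⟨R, hR⟩ := exists_isResolvent_neg (A := A) hB hT (a := a) (by linarith)
    have hR' := hnull.exists_isResolvent_restrictTo
      (neg_ne_zero.2 (Complex.ofReal_ne_zero.2 ha0.ne')) hR
    have hγT : 0 < γ / T := by positivity
    have hleft : ∀ w' ∈ {w' : ℂ | w'.re ≤ 0}, w' ∉ truncatedSector T γ p c :=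
      fun w' (hw' : w'.re ≤ 0) h => absurd (h.1.trans hw') (not_le.2 hγT)
    -- From `-a`, continue inside the left half-plane to the height of `w`, then horizontally to
    -- `w`. Decreasing the real part at fixed height never enters the sector.
    have h1 : ∃ R, IsResolvent (restrictTo (coupledOp A B) (ℂ ∙ δ)ᗮ)
        ⟨min w.re 0, w.im⟩ R := by
      refine exists_isResolvent_of_convex (convex_halfSpace_re_le 0) hm
        (fun w' hw' => hlow1 w' (hleft w' hw')) (w₀ := (-a : ℂ)) ?_ ?_ hR'
      · simpa using ha0.le
      · simp
    refine exists_isResolvent_of_convex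
      (S := {w' : ℂ | w'.re ≤ w.re} ∩ {w' : ℂ | w'.im = w.im})
      ((convex_halfSpace_re_le _).inter ?_) hm (fun w' hw' => hlow1 w' fun h => hw ?_)
      (w₀ := ⟨min w.re 0, w.im⟩) ⟨min_le_left w.re 0, rfl⟩ ⟨le_refl w.re, rfl⟩ h1
    · exact convex_hyperplane Complex.imLm.isLinear w.im
    · refine ⟨h.1.trans hw'.1, ?_⟩
      have h2 := h.2
      rw [hw'.2] at h2
      have h3 : w'.re ≤ w.re := hw'.1
      exact h2.trans (mul_le_mul_of_nonneg_left (by linarith) hp.le)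
  refine ⟨γ, p, c, hγ0, hγ1, hp, hc, fun w hw => ?_, 1 / m + 1, fun w hw => ?_⟩
  · by_contra h
    exact hw (hres w h)
  · rw [Set.mem_union, not_or, Set.mem_singleton_iff] at hw
    obtain ⟨R, hR⟩ := hres w hw.2
    obtain ⟨R', hR', hn⟩ := hnull.exists_isResolvent hw.1 hR
    refine ⟨R', hR', hn.trans ?_⟩
    have hw0 : 0 < ‖w‖ := norm_pos_iff.2 hw.1
    have hRn : ‖R‖ ≤ 1 / (m * (1 + ‖w‖)) := hR.norm_le (by positivity) (hlow' w hw.2)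
    have hclosed : IsClosed ({0} ∪ truncatedSector T γ p c) := by
      refine isClosed_singleton.union (IsClosed.inter ?_ ?_)
      · exact isClosed_le continuous_const Complex.continuous_re
      · exact isClosed_le (f := fun w : ℂ => |w.im|) (g := fun w => p * (w.re + c))
          Complex.continuous_im.abs (by fun_prop)
    have hdpos : 0 < Metric.infDist w ({0} ∪ truncatedSector T γ p c) :=
      (hclosed.notMem_iff_infDist_pos ⟨0, Or.inl rfl⟩).1 (by
        rw [Set.mem_union, not_or]; exact hw)
    have hdle : Metric.infDist w ({0} ∪ truncatedSector T γ p c) ≤ ‖w‖ := by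
      have := Metric.infDist_le_dist_of_mem (x := w)
        (show (0 : ℂ) ∈ ({0} ∪ truncatedSector T γ p c : Set ℂ) from Or.inl rfl)
      rwa [dist_zero_right] at this
    -- The growth of the lower bound in `‖w‖` gives a resolvent bound of order `1 / ‖w‖`, and the
    -- distance is at most `‖w‖` because `0` belongs to the set.
    calc ‖R‖ + 1 / ‖w‖ ≤ 1 / (m * ‖w‖) + 1 / ‖w‖ := by
          refine add_le_add (hRn.trans ?_) le_rfl
          gcongr
          linarith
      _ = (1 / m + 1) / ‖w‖ := by field_simp
      _ ≤ (1 / m + 1) / Metric.infDist w ({0} ∪ truncatedSector T γ p c) := by gcongr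

end IsCoupling

end HilbertSum

/-! ### The hopping and potential terms -/

section Multiplication

variable {α : Type*} [MeasurableSpace α] {ν : Measure α}

theorem coeFn_mulL2 (m : Lp ℂ ∞ ν) (f : Lp ℂ 2 ν) :
    mulL2 m f =ᵐ[ν] fun a => m a * f a :=
  (ContinuousLinearMap.mul ℂ ℂ).coeFn_holder (r := 2) m f

theorem inner_mulL2 {m : Lp ℂ ∞ ν} (hm : ∀ᵐ a ∂ν, starRingEnd ℂ (m a) = m a) (f g : Lp ℂ 2 ν) :
    ⟪f, mulL2 m g⟫_ℂ = ⟪mulL2 m f, g⟫_ℂ := by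
  rw [L2.inner_def, L2.inner_def]
  refine integral_congr_ae ?_
  filter_upwards [coeFn_mulL2 m f, coeFn_mulL2 m g, hm] with a hf hg ha
  rw [hf, hg]
  simp only [RCLike.inner_apply, map_mul, ha]
  ring

theorem norm_constOne [IsProbabilityMeasure ν] : ‖Lp.const 2 ν (1 : ℂ)‖ = 1 := by
  rw [Lp.norm_const' _ _ _ (by simp) (by simp)]
  simp

theorem inner_constOne [IsProbabilityMeasure ν] (f : Lp ℂ 2 ν) :
    ⟪Lp.const 2 ν (1 : ℂ), f⟫_ℂ = ∫ a, f a ∂ν := by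
  rw [← indicatorConstLp_univ, L2.inner_indicatorConstLp_one, setIntegral_univ]

end Multiplication

section Translate

variable {d : ℕ} {Ω : Type*} [MeasurableSpace Ω] {μ : Measure Ω}

theorem translate_apply (ζ : Fin d → ℤ) (U : Lp ℂ 2 μ →L[ℂ] Lp ℂ 2 μ) (x : AugSpace d μ)
    (i : Fin d → ℤ) : translate ζ U x i = U (x (i - ζ)) := rfl

theorem norm_translate_le (ζ : Fin d → ℤ) (U : Lp ℂ 2 μ →L[ℂ] Lp ℂ 2 μ) :
    ‖translate ζ U‖ ≤ ‖U‖ := by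
  have h : ‖translate ζ U‖ ≤ max ‖U‖ 0 := by
    unfold translate blockOp
    exact LinearMap.mkContinuous_norm_le _ (le_max_right _ _) _
  rwa [max_eq_left (norm_nonneg U)] at h

/-- Reindexing the sum over sites by `ζ` reverses the translation. -/
theorem inner_translate {U U' : Lp ℂ 2 μ →L[ℂ] Lp ℂ 2 μ} (h : ∀ f g, ⟪f, U g⟫_ℂ = ⟪U' f, g⟫_ℂ)
    (ζ : Fin d → ℤ) (x y : AugSpace d μ) :
    ⟪x, translate ζ U y⟫_ℂ = ⟪translate (-ζ) U' x, y⟫_ℂ := by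
  rw [lp.inner_eq_tsum, lp.inner_eq_tsum, ← (Equiv.addRight ζ).tsum_eq]
  refine tsum_congr fun i => ?_
  rw [translate_apply, translate_apply, h, Equiv.coe_addRight, sub_neg_eq_add]
  simp only [add_sub_cancel_right]

end Translate

/-! ### Hopping and potential as a coupling -/

namespace Environment

variable {d : ℕ} {Ω : Type*} [MeasurableSpace Ω] {μ : Measure Ω} [TopologicalSpace Ω]
  (X : Environment d μ)

theorem norm_shiftL2_le (ζ : Fin d → ℤ) : ‖X.shiftL2 ζ‖ ≤ 1 :=
  LinearIsometry.norm_toContinuousLinearMap_le _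

theorem shiftL2_shiftL2_neg (ζ : Fin d → ℤ) (f : Lp ℂ 2 μ) :
    X.shiftL2 ζ (X.shiftL2 (-ζ) f) = f := by
  change Lp.compMeasurePreserving _ (X.σ_preserving ζ)
    (Lp.compMeasurePreserving _ (X.σ_preserving (-ζ)) f) = f
  rw [← Lp.compMeasurePreserving_comp_apply]
  have h : X.σ (-ζ) ∘ X.σ ζ = id := by
    rw [X.σ_add, neg_add_cancel, X.σ_zero]
  simp only [h]
  exact Lp.compMeasurePreserving_id_apply f

theorem inner_shiftL2 (ζ : Fin d → ℤ) (f g : Lp ℂ 2 μ) :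
    ⟪f, X.shiftL2 ζ g⟫_ℂ = ⟪X.shiftL2 (-ζ) f, g⟫_ℂ := by
  nth_rewrite 1 [← X.shiftL2_shiftL2_neg ζ f]
  exact LinearIsometry.inner_map_map _ _ _

/-- The contribution of jumps by `ζ` to the hopping term at `z = 0`. -/
def jump (ζ : Fin d → ℤ) : AugSpace d μ →L[ℂ] AugSpace d μ :=
  translate ζ (ContinuousLinearMap.id ℂ (Lp ℂ 2 μ)) - translate ζ (X.shiftL2 ζ)

theorem inner_jump (ζ : Fin d → ℤ) (x y : AugSpace d μ) :
    ⟪x, X.jump ζ y⟫_ℂ = ⟪X.jump (-ζ) x, y⟫_ℂ := by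
  simp only [jump, sub_apply, inner_sub_left, inner_sub_right]
  rw [inner_translate (U' := ContinuousLinearMap.id ℂ (Lp ℂ 2 μ)) (fun _ _ => rfl),
    inner_translate (X.inner_shiftL2 ζ)]

theorem norm_jump_le (ζ : Fin d → ℤ) : ‖X.jump ζ‖ ≤ 2 := by
  refine (norm_sub_le _ _).trans ?_
  have h1 := (norm_translate_le ζ (ContinuousLinearMap.id ℂ (Lp ℂ 2 μ))).trans
    ContinuousLinearMap.norm_id_le
  have h2 := (norm_translate_le ζ (X.shiftL2 ζ)).trans (X.norm_shiftL2_le ζ)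
  linarith

theorem hopping_zero (k : HoppingKernel d) :
    X.hopping k 0 = ∑' ζ : Fin d → ℤ, k.h ζ • X.jump ζ := by
  simp [hopping, jump]

theorem summable_jump (k : HoppingKernel d) :
    Summable fun ζ : Fin d → ℤ => k.h ζ • X.jump ζ := by
  obtain ⟨m, hm, hs⟩ := k.exp_bound
  refine Summable.of_norm_bounded (hs.mul_right 2) fun ζ => ?_
  rw [norm_smul]
  refine mul_le_mul ?_ (X.norm_jump_le ζ) (norm_nonneg _) (by positivity)
  exact le_mul_of_one_le_left (norm_nonneg _) (Real.one_le_exp (by positivity))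

theorem inner_hopping (k : HoppingKernel d) (x y : AugSpace d μ) :
    ⟪x, X.hopping k 0 y⟫_ℂ = ⟪X.hopping k 0 x, y⟫_ℂ := by
  have hs := X.summable_jump k
  have h1 : HasSum (fun ζ => ⟪x, (k.h ζ • X.jump ζ) y⟫_ℂ) ⟪x, X.hopping k 0 y⟫_ℂ := by
    rw [hopping_zero]
    exact ((hs.hasSum.mapL (ContinuousLinearMap.apply ℂ _ y)).mapL (innerSL ℂ x))
  have h2 : HasSum (fun ζ => ⟪(k.h ζ • X.jump ζ) x, y⟫_ℂ) ⟪X.hopping k 0 x, y⟫_ℂ := by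
    rw [hopping_zero]
    have h3 := (hs.hasSum.mapL (ContinuousLinearMap.apply ℂ _ x)).mapL (innerSL ℂ y)
    have h4 := h3.star
    simp only [innerSL_apply_apply, ContinuousLinearMap.apply_apply, ← starRingEnd_apply,
      inner_conj_symm] at h4
    exact h4
  -- The adjoint of a jump by `ζ` is the jump by `-ζ`, so substituting `ζ ↦ -ζ` and `h(ζ) = conj
  -- h(-ζ)` matches the two series.
  refine h1.unique ((Equiv.neg _).hasSum_iff.1 ?_)
  convert h2 using 2 with ζ
  simp only [Function.comp_apply, Equiv.neg_apply, smul_apply, inner_smul_left, inner_smul_right]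
  rw [X.inner_jump, neg_neg, k.self_adjoint ζ, starRingEnd_self_apply]

theorem potentialAt_coeFn {v : Ω → ℝ} (hv : MemLp v ∞ μ) (x : Fin d → ℤ) :
    ∀ᵐ ω ∂μ, (X.potentialAt hv x - X.potentialAt hv 0 : Lp ℂ ∞ μ) ω =
      ((v (X.σ x ω) - v (X.σ 0 ω) : ℝ) : ℂ) := by
  filter_upwards [Lp.coeFn_sub (X.potentialAt hv x) (X.potentialAt hv 0),
    (X.memLp_ofReal_shift hv x).coeFn_toLp, (X.memLp_ofReal_shift hv 0).coeFn_toLp] with ω h1 h2 h3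
  rw [h1, Pi.sub_apply, potentialAt, potentialAt, h2, h3, Complex.ofReal_sub]

theorem potential_apply {v : Ω → ℝ} (hv : MemLp v ∞ μ) (φ : AugSpace d μ) (x : Fin d → ℤ) :
    X.potential hv φ x = mulL2 (X.potentialAt hv x - X.potentialAt hv 0) (φ x) := rfl

theorem inner_potential {v : Ω → ℝ} (hv : MemLp v ∞ μ) (x y : AugSpace d μ) :
    ⟪x, X.potential hv y⟫_ℂ = ⟪X.potential hv x, y⟫_ℂ := by
  rw [lp.inner_eq_tsum, lp.inner_eq_tsum]
  refine tsum_congr fun i => inner_mulL2 ?_ _ _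
  filter_upwards [X.potentialAt_coeFn hv i] with ω h
  rw [h, Complex.conj_ofReal]

theorem L_zero_eq (k : HoppingKernel d) {v : Ω → ℝ} (hv : MemLp v ∞ μ) :
    X.L k hv 0 = coupledOp (X.hopping k 0 + X.potential hv) X.B := by
  rw [L, coupledOp, smul_add]

variable [IsProbabilityMeasure μ]

/-- Constants are shift invariant, so the two halves of a jump cancel on them. -/
theorem jump_alongPart (ζ : Fin d → ℤ) (x : AugSpace d μ) :
    X.jump ζ (alongPart (Lp.const 2 μ 1) x) = 0 := by
  have h : X.shiftL2 ζ (Lp.const 2 μ 1) = Lp.const 2 μ 1 := rfl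
  ext i : 2
  change alongPart (Lp.const 2 μ 1) x (i - ζ) -
    X.shiftL2 ζ (alongPart (Lp.const 2 μ 1) x (i - ζ)) = 0
  rw [alongPart_apply, map_smul, h, sub_self]

theorem hopping_alongPart (k : HoppingKernel d) (x : AugSpace d μ) :
    X.hopping k 0 (alongPart (Lp.const 2 μ 1) x) = 0 := by
  have h := (X.summable_jump k).hasSum.mapL
    (ContinuousLinearMap.apply ℂ _ (alongPart (Lp.const 2 μ 1) x))
  rw [hopping_zero]
  refine h.unique ?_
  convert hasSum_zero using 2 with ζ
  simp [X.jump_alongPart]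

/-- The function `v_x - v_0` in `L²`. -/
def potentialDiff {v : Ω → ℝ} (hv : MemLp v ∞ μ) (x : Fin d → ℤ) : Lp ℂ 2 μ :=
  mulL2 (X.potentialAt hv x - X.potentialAt hv 0) (Lp.const 2 μ 1)

theorem coeFn_potentialDiff {v : Ω → ℝ} (hv : MemLp v ∞ μ) (x : Fin d → ℤ) :
    X.potentialDiff hv x =ᵐ[μ] fun ω => ((v (X.σ x ω) - v (X.σ 0 ω) : ℝ) : ℂ) := by
  filter_upwards [X.potentialAt_coeFn hv x, coeFn_mulL2 (X.potentialAt hv x - X.potentialAt hv 0)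
    (Lp.const 2 μ 1), Lp.coeFn_const 2 μ (1 : ℂ)] with ω h1 h2 h3
  rw [potentialDiff, h2, h1, h3, Function.const_apply, mul_one]

/-- The shifts preserve `μ`, so `v_x` and `v_0` have the same mean. -/
theorem inner_constOne_potentialDiff {v : Ω → ℝ} (hv : MemLp v ∞ μ) (x : Fin d → ℤ) :
    ⟪Lp.const 2 μ (1 : ℂ), X.potentialDiff hv x⟫_ℂ = 0 := by
  have h : ∀ y, ∫ ω, v (X.σ y ω) ∂μ = ∫ ω, v ω ∂μ := fun y => by
    have hσ := X.σ_preserving y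
    conv_rhs => rw [← hσ.map_eq]
    exact (integral_map hσ.aemeasurable (by rw [hσ.map_eq]; exact hv.1)).symm
  have hint : ∀ y, Integrable (fun ω => v (X.σ y ω)) μ := fun y =>
    (hv.comp_measurePreserving (X.σ_preserving y)).integrable le_top
  rw [inner_constOne, integral_congr_ae (X.coeFn_potentialDiff hv x), integral_complex_ofReal,
    integral_sub (hint x) (hint 0), h, h, sub_self, Complex.ofReal_zero]

theorem isCoupling (k : HoppingKernel d) {v : Ω → ℝ} (hv : MemLp v ∞ μ) {χ : ℝ}
    (hnd : X.PotentialNondegenerate v χ) :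
    IsCoupling (X.hopping k 0 + X.potential hv) X.B (Lp.const 2 μ 1) 0 (X.potentialDiff hv) χ where
  symm x y := by
    rw [add_apply, add_apply, inner_add_left, inner_add_right, X.inner_hopping, X.inner_potential]
  apply_alongPart x i := by
    rw [add_apply, X.hopping_alongPart, zero_add, potential_apply, alongPart_apply, map_smul]
    rfl
  apply_origin := by
    rw [potentialDiff, sub_self, mulL2, map_zero, zero_apply]
  inner_eq_zero := X.inner_constOne_potentialDiff hv
  nondegenerate i hi u hu hu0 := by
    obtain ⟨y, hy, hz⟩ := (LinearPMap.mem_graph_iff _).1 hu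
    simp only at hy hz
    rw [← hy]
    rw [← hy, inner_constOne] at hu0
    refine hnd i hi y hu0 ?_
    rw [hz]
    exact X.coeFn_potentialDiff hv i

/-- `S_t†` fixes constants and preserves the mean, which makes `1` a null vector on both sides; the
resolvents at negative points are Laplace transforms. -/
theorem isGapped_B [BorelSpace Ω] {T q b : ℝ} (hgap : X.HasGap T) (hsec : X.IsSectorial q b) :
    IsGapped X.B (Lp.const 2 μ 1) T q b where
  norm_eq_one := norm_constOne
  mem_graph := by
    rw [B, mem_generator_graph]
    simp only [adjSemigroup_const, sub_self, smul_zero]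
    exact tendsto_const_nhds
  inner_eq_zero x z hxz := by
    rw [B, mem_generator_graph] at hxz
    have h := tendsto_const_nhds (x := Lp.const 2 μ (1 : ℂ)).inner (𝕜 := ℂ) hxz
    refine tendsto_nhds_unique h ?_
    simp only [inner_smul_right, inner_sub_right, inner_const_adjSemigroup, sub_self, mul_zero]
    exact tendsto_const_nhds
  gap x z hxz hx := by
    obtain ⟨y, hy, hz⟩ := (LinearPMap.mem_graph_iff _).1 hxz
    simp only at hy hz
    rw [← hy, ← hz]
    rw [← hy, inner_constOne] at hx
    exact hgap y hx
  sectorial x z hxz hx hn := by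
    obtain ⟨y, hy, hz⟩ := (LinearPMap.mem_graph_iff _).1 hxz
    simp only at hy hz
    rw [← hy, ← hz]
    rw [← hy, inner_constOne] at hx
    rw [← hy] at hn
    exact hsec y hx hn
  exists_isResolvent_neg a ha := ⟨_, X.isContractionSemigroup_adjSemigroup.isResolvent_laplace ha⟩

end Environment

end MarkovAnderson

end

theorem mainTheorem4 {d : ℕ} {Ω : Type*} [TopologicalSpace Ω] [MeasurableSpace Ω] [BorelSpace Ω]
    {μ : Measure Ω} [IsProbabilityMeasure μ]
    (k : HoppingKernel d) (X : Environment d μ)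
    (T q b : ℝ) (hT : 0 < T) (hgap : X.HasGap T) (hsec : X.IsSectorial q b)
    (v : Ω → ℝ) (hv : MemLp v ∞ μ) (χ : ℝ) (hχ : 0 < χ) (hnd : X.PotentialNondegenerate v χ) :
    -- `L̂₀` is densely defined, and `δ₀ ⊗ 1` is in the kernel of `L̂₀` and of its adjoint
    Dense ((X.L k hv 0).domain : Set (AugSpace d μ)) ∧
    (∃ hδ : deltaOne d μ ∈ (X.L k hv 0).domain, X.L k hv 0 ⟨deltaOne d μ, hδ⟩ = 0) ∧
    (∃ hδ : deltaOne d μ ∈ (X.L k hv 0).adjoint.domain, (X.L k hv 0).adjoint ⟨deltaOne d μ, hδ⟩ = 0) ∧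
    -- the orthogonal complement of `δ₀ ⊗ 1` is invariant
    (∀ φ : (X.L k hv 0).domain, (φ : AugSpace d μ) ∈ (ℂ ∙ deltaOne d μ)ᗮ →
      X.L k hv 0 φ ∈ (ℂ ∙ deltaOne d μ)ᗮ) ∧
    -- location of the spectrum and resolvent bound
    ∃ γ p c : ℝ, 0 < γ ∧ γ < 1 ∧ 0 < p ∧ 0 < c ∧
      pspectrum (restrictTo (X.L k hv 0) (ℂ ∙ deltaOne d μ)ᗮ) ⊆ truncatedSector T γ p c ∧
      ∃ C : ℝ, ∀ w : ℂ, w ∉ {0} ∪ truncatedSector T γ p c →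
        ∃ R : AugSpace d μ →L[ℂ] AugSpace d μ, IsResolvent (X.L k hv 0) w R ∧
          ‖R‖ ≤ C / Metric.infDist w ({0} ∪ truncatedSector T γ p c) := by
  have hB := X.isGapped_B hgap hsec
  have hA := X.isCoupling k hv hnd
  have hnull : IsNullVector (coupledOp (X.hopping k 0 + X.potential hv) X.B) (deltaOne d μ) :=
    hA.isNullVector hB.toIsNullVector
  rw [X.L_zero_eq k hv]
  have hdense : Dense ((coupledOp (X.hopping k 0 + X.potential hv) X.B).domain :
      Set (AugSpace d μ)) := by
    have ha : ‖X.hopping k 0 + X.potential hv‖ < ‖X.hopping k 0 + X.potential hv‖ + 1 :=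
      lt_add_one _
    obtain ⟨R, hR⟩ := IsCoupling.exists_isResolvent_neg hB hT ha
    exact dense_domain_of_accretive (fun x z hxz => hA.re_inner_nonneg hB hT hxz) (by positivity) hR
  have hinner : ∀ x : (coupledOp (X.hopping k 0 + X.potential hv) X.B).domain,
      inner ℂ (deltaOne d μ) (coupledOp (X.hopping k 0 + X.potential hv) X.B x) = 0 := fun x =>
    hnull.inner_eq_zero _ _ (LinearPMap.mem_graph _ x)
  -- Orthogonality of `δ₀ ⊗ 1` to the range yields both its membership in the kernel of the adjoint
  -- and the invariance of its complement.
  have hadj : deltaOne d μ ∈ (coupledOp (X.hopping k 0 + X.potential hv) X.B).adjoint.domain :=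
    LinearPMap.mem_adjoint_domain_of_exists _ ⟨0, fun x => by rw [hinner, inner_zero_left]⟩
  refine ⟨hdense, ?_, ⟨hadj, ?_⟩, fun φ _ => ?_, hA.exists_truncatedSector hB hT hχ⟩
  · obtain ⟨y, hy, hz⟩ := (LinearPMap.mem_graph_iff _).1 hnull.mem_graph
    have hmem := y.2
    rw [hy] at hmem
    exact ⟨hmem, (congrArg _ (Subtype.ext hy.symm)).trans hz⟩
  · exact LinearPMap.adjoint_apply_eq hdense _ fun x => by rw [hinner, inner_zero_left]
  · rw [Submodule.mem_orthogonal_singleton_iff_inner_right]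
    exact hinner φ
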